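/- **Setting.** A *2-group* is a monoidal groupoid $(\mathbb G,\otimes,I,a,l,r)$ in which every object is invertible up to isomorphism. $\pi_0(\mathbb G)$ is the group of isomorphism classes of objects, $\pi_1(\mathbb G)=\mathrm{Aut}(I)$, and for each object $A$ the isomorphisms $\gamma_A,\delta_A:\pi_1(\mathbb G)\to\mathrm{Aut}(A)$ are $\gamma_A(u)=l_A\circ(u\otimes \mathrm{id}_A)\circ l_A^{-1}$ and $\delta_A(u)=r_A\circ(\mathrm{id}_A\otimes u)\circ r_A^{-1}$; $\pi_0(\mathbb G)$ acts on $\pi_1(\mathbb G)$ by $[A]\cdot u=\gamma_A^{-1}(\delta_A(u))$. A 2-group $\mathbb S$ is *special* if isomorphic objects are equal, $l$ and $r$ are identities and every object is strictly invertible; it then has the 3-cocycle $\alpha(g_1,g_2,g_3)=\gamma^{-1}_{g_1g_2g_3}(a_{g_1,g_2,g_3})$. Every 2-group $\mathbb G$ is equivalent to a special one. Fix a 2-group $\mathbb G$, a special 2-group $\mathbb S$ and a monoidal equivalence $E:\mathbb G\to\mathbb S$ (if $\mathbb G$ is special one can take $E=\mathrm{id}$). $\mathbf{2Mat}_{\mathbb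 C}$ is the 2-category of complex 2-matrices. Its objects are the natural numbers. A 1-morphism $n\to m$ is an $m\times n$ matrix $R$ over $\mathbb N$ with a gauge, i.e. invertible complex matrices $s_i(a)$ of size $\sum_jR_{ij}a_j$ ($a\in\mathbb N^n$, $1\le i\le m$) with $s_i(e_j)=1$. A 2-morphism $(R,s)\Rightarrow(R',s')$ is a matrix whose $(i,j)$ entry is a complex $R'_{ij}\times R_{ij}$ matrix. Vertical composition is the entrywise product. The composite $(\tilde R,\tilde s)\circ(R,s)$ is $\tilde RR$ with the gauge $\tilde s_k(Ra)\big(\bigoplus_i1\otimes s_i(a)\big)P\big(\bigoplus_j\tilde s_k(Re_j)^{-1}\otimes1\big)$, where $P$ is the canonical permutation matrix exchanging the two orders of summation, and $(\tilde T\circ T)_{kj}=\tilde s'_k(R'e_j)\big(\bigoplus_i\tilde T_{ki}\otimes T_{ij}\big)\tilde s_k(Re_j)^{-1}$. A *representation* of $\mathbb G$ is a pseudofunctor from the one-object bicategory of $\mathbb G$ (with $g\circ f=g\otimes f$) to $\mathbf{2Mat}_{\mathbb C}$. $\mathbf{Hom}(\mathcal F,\mathcal F')$ is the category of pseudonatural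 transformations $\mathcal F\to\mathcal F'$ and modifications. A *pair* $(\beta,c)$ consists of a $\pi_0(\mathbb S)$-invariant homomorphism $\beta:\pi_1(\mathbb S)\to\mathbb C^*$ and a normalized 2-cochain $c$ of $\pi_0(\mathbb S)\cong\pi_0(\mathbb G)$ with values in the trivial module $\mathbb C^*$ such that $\partial c=\beta\circ\alpha$. The 1-dimensional representation $\mathbb I_{\beta,c}$ of $\mathbb S$ sends every object $g$ to the identity of the object $1$, a morphism $\varphi:g\to g$ to the scalar $\beta(\gamma_g^{-1}(\varphi))$, and has structural isomorphisms $F(g_1)\circ F(g_2)\Rightarrow F(g_1g_2)$ given by the scalars $c(g_1,g_2)$, and identity unit constraint. The representation of $\mathbb G$ obtained by restriction along $E$ is also denoted $\mathbb I_{\beta,c}$. For a group $\Gamma$ and a 2-cocycle $z$ of $\Gamma$ with values in the trivial module $\mathbb C^*$, $\mathbf{PRep}_z(\Gamma)$ is the category of finite-dimensional matrix projective representations with cocycle $z$: the objects are maps $S:\Gamma\to GL_r(\mathbb C)$ ($r\ge0$) with $S(g)S(h)=z(g,h)S(gh)$, and the morphisms $S\to S'$ are the matrices $T$ with $TS(g)=S'(g)T$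 for all $g$. $\mathbf{Rep}_{\mathbf{Mat}_{\mathbb C}}(\Gamma)$ is the monoidal category of homomorphisms $\Gamma\to GL_r(\mathbb C)$ ($r\ge0$) and intertwining matrices, with the Kronecker tensor product. **Theorem.** Let $(\beta,c)$ and $(\beta',c')$ be two pairs. 1. If $\beta\neq\beta'$, then $\mathbf{Hom}(\mathbb I_{\beta,c},\mathbb I_{\beta',c'})$ is equivalent to the terminal category $\mathbf 1$. 2. If $\beta=\beta'$, then $c'-c$ (pointwise $c'/c$, regarded as a cochain on $\pi_0(\mathbb G)$) is a 2-cocycle, and $\mathbf{Hom}(\mathbb I_{\beta,c},\mathbb I_{\beta',c'})$ is equivalent to the category of projective representations of $\pi_0(\mathbb G)$ with class $[c'-c]\in H^2(\pi_0(\mathbb G),\mathbb C^*)$: for every 2-cocycle $z$ with $[z]=[c'-c]$ it is equivalent to $\mathbf{PRep}_z(\pi_0(\mathbb G))$. 3. The category $\mathbf{End}(\mathbb I_{\beta,c})=\mathbf{Hom}(\mathbb I_{\beta,c},\mathbb I_{\beta,c})$, with the monoidal structure $\xi'\otimes\xi=\xi'\circ\xi$ given by composition, is equivalent as a monoidal category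 to $\mathbf{Rep}_{\mathbf{Mat}_{\mathbb C}}(\pi_0(\mathbb G))$. -/

import Mathlib

open CategoryTheory Matrix
open scoped Kronecker

set_option linter.unusedSectionVars false
set_option linter.unusedSimpArgs false

noncomputable section

namespace TwoRep

/-- The permutation matrix of a bijection. -/
def permMat {α β : Type} [DecidableEq β] (σ : α ≃ β) : Matrix β α ℂ :=
  (1 : Matrix β β ℂ).submatrix id σ

section permMat
variable {α β γ δ : Type} [DecidableEq α] [DecidableEq β] [DecidableEq γ] [DecidableEq δ]

theorem permMat_mul [Fintype α] (σ : α ≃ β) (M : Matrix α γ ℂ) :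
    permMat σ * M = M.submatrix σ.symm id := by
  ext b c
  simp only [permMat, Matrix.mul_apply, Matrix.one_apply, ite_mul, one_mul, zero_mul,
    Matrix.submatrix_apply, id]
  rw [Finset.sum_eq_single (σ.symm b)]
  · simp
  · intro a _ ha
    rw [if_neg]
    rintro rfl
    simp at ha
  · simp

theorem mul_permMat [Fintype β] (σ : α ≃ β) (M : Matrix γ β ℂ) :
    M * permMat σ = M.submatrix id σ := by
  ext b c
  simp [permMat, Matrix.mul_apply, Matrix.one_apply]

theorem permMat_refl : permMat (Equiv.refl α) = 1 := by
  rfl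

theorem permMat_mul_permMat [Fintype β] (σ : α ≃ β) (τ : β ≃ γ) :
    permMat τ * permMat σ = permMat (σ.trans τ) := by
  rw [mul_permMat]; rfl

theorem permMat_one_kronecker (σ : α ≃ β) :
    (1 : Matrix γ γ ℂ) ⊗ₖ permMat σ = permMat ((Equiv.refl γ).prodCongr σ) := by
  ext ⟨a, b⟩ ⟨c, d⟩
  simp only [permMat, Matrix.one_apply, Matrix.kroneckerMap_apply, Matrix.submatrix_apply,
    Equiv.prodCongr_apply, Equiv.coe_refl, Prod.map, id, Prod.mk.injEq]
  split_ifs <;> simp_all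

theorem permMat_kronecker_one (σ : α ≃ β) :
    permMat σ ⊗ₖ (1 : Matrix γ γ ℂ) = permMat (σ.prodCongr (Equiv.refl γ)) := by
  ext ⟨a, b⟩ ⟨c, d⟩
  simp only [permMat, Matrix.one_apply, Matrix.kroneckerMap_apply, Matrix.submatrix_apply,
    Equiv.prodCongr_apply, Equiv.coe_refl, Prod.map, id, Prod.mk.injEq]
  split_ifs <;> simp_all

theorem blockDiagonal'_permMat {ι : Type} [DecidableEq ι] {A B : ι → Type}
    [∀ i, DecidableEq (A i)] [∀ i, DecidableEq (B i)] (σ : ∀ i, A i ≃ B i) :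
    Matrix.blockDiagonal' (fun i => permMat (σ i)) = permMat (Equiv.sigmaCongrRight σ) := by
  ext ⟨i, a⟩ ⟨j, b⟩
  by_cases h : i = j
  · subst h
    simp [permMat, Matrix.one_apply]
  · rw [Matrix.blockDiagonal'_apply_ne _ _ _ h]
    simp [permMat, Matrix.one_apply, h]

end permMat

/-- Auxiliary version of the 1-morphisms of 2-matrices, without gauges and with arbitrary finite
sets instead of natural numbers as entries. -/
structure SetMat (m n : ℕ) where
  E : Fin n → Fin m → Type
  [fintypeE : ∀ i j, Fintype (E i j)]
  [decEqE : ∀ i j, DecidableEq (E i j)]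

attribute [instance] SetMat.fintypeE SetMat.decEqE

instance (m n : ℕ) : Category (SetMat m n) where
  Hom R S := ∀ i j, Matrix (S.E i j) (R.E i j) ℂ
  id R := fun i j => 1
  comp T U := fun i j => U i j * T i j
  id_comp T := by funext i j; exact Matrix.mul_one _
  comp_id T := by funext i j; exact Matrix.one_mul _
  assoc T U V := by funext i j; exact (Matrix.mul_assoc _ _ _).symm

namespace SetMat

theorem id_app {m n : ℕ} (R : SetMat m n) (i j) : (𝟙 R : R ⟶ R) i j = 1 := rfl
theorem comp_app {m n : ℕ} {R S T : SetMat m n} (f : R ⟶ S) (g : S ⟶ T) (i j) :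
  (f ≫ g) i j = g i j * f i j := rfl

theorem hom_ext {m n : ℕ} {R S : SetMat m n} {f g : R ⟶ S} (h : ∀ i j, f i j = g i j) : f = g :=
  funext fun i => funext fun j => h i j

/-- The isomorphism given by entrywise bijections. -/
def permIso {m n : ℕ} {R S : SetMat m n} (σ : ∀ i j, R.E i j ≃ S.E i j) : R ≅ S where
  hom := fun i j => permMat (σ i j)
  inv := fun i j => permMat (σ i j).symm
  hom_inv_id := by
    refine hom_ext fun i j => ?_
    rw [comp_app, permMat_mul_permMat, id_app, ← permMat_refl]; simp
  inv_hom_id := by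
    refine hom_ext fun i j => ?_
    rw [comp_app, permMat_mul_permMat, id_app, ← permMat_refl]; simp

/-- The identity matrix. -/
abbrev one (n : ℕ) : SetMat n n where
  E i j := PLift (i = j)

/-- The product of matrices of finite sets. -/
abbrev mul {m n p : ℕ} (R : SetMat m n) (S : SetMat n p) : SetMat m p where
  E k j := Σ i, S.E k i × R.E i j

/-- Left whiskering. -/
def wl {m n p : ℕ} (R : SetMat m n) {S S' : SetMat n p} (T : S ⟶ S') : R.mul S ⟶ R.mul S' :=
  fun k j => Matrix.blockDiagonal' fun i => T k i ⊗ₖ (1 : Matrix (R.E i j) (R.E i j) ℂ)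

/-- Right whiskering. -/
def wr {m n p : ℕ} {R R' : SetMat m n} (T : R ⟶ R') (S : SetMat n p) : R.mul S ⟶ R'.mul S :=
  fun k j => Matrix.blockDiagonal' fun i => (1 : Matrix (S.E k i) (S.E k i) ℂ) ⊗ₖ T i j

variable {m n p q : ℕ}

theorem wl_id (R : SetMat m n) (S : SetMat n p) : wl R (𝟙 S) = 𝟙 (R.mul S) := by
  refine hom_ext fun k j => ?_
  simp only [wl, id_app, Matrix.one_kronecker_one]
  exact Matrix.blockDiagonal'_one

theorem wl_comp (R : SetMat m n) {S T U : SetMat n p} (f : S ⟶ T) (g : T ⟶ U) :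
    wl R (f ≫ g) = wl R f ≫ wl R g := by
  refine hom_ext fun k j => ?_
  rw [comp_app, wl, wl, wl, ← Matrix.blockDiagonal'_mul]
  simp only [comp_app, ← Matrix.mul_kronecker_mul, one_mul]

theorem wr_id (R : SetMat m n) (S : SetMat n p) : wr (𝟙 R) S = 𝟙 (R.mul S) := by
  refine hom_ext fun k j => ?_
  simp only [wr, id_app, Matrix.one_kronecker_one]
  exact Matrix.blockDiagonal'_one

theorem wr_comp {R S T : SetMat m n} (f : R ⟶ S) (g : S ⟶ T) (U : SetMat n p) :
    wr (f ≫ g) U = wr f U ≫ wr g U := by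
  refine hom_ext fun k j => ?_
  rw [comp_app, wr, wr, wr, ← Matrix.blockDiagonal'_mul]
  simp only [comp_app, ← Matrix.mul_kronecker_mul, one_mul]

theorem exchange {R R' : SetMat m n} {S S' : SetMat n p} (f : R ⟶ R') (g : S ⟶ S') :
    wl R g ≫ wr f S' = wr f S ≫ wl R' g := by
  refine hom_ext fun k j => ?_
  rw [comp_app, comp_app, wr, wl, wr, wl, ← Matrix.blockDiagonal'_mul, ← Matrix.blockDiagonal'_mul]
  simp only [← Matrix.mul_kronecker_mul, Matrix.one_mul, Matrix.mul_one]

/-- Reassociation of a triple product. -/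
def assocE (R : SetMat m n) (S : SetMat n p) (T : SetMat p q) (l j) :
    (R.mul (S.mul T)).E l j ≃ ((R.mul S).mul T).E l j where
  toFun x := ⟨x.2.1.1, x.2.1.2.1, ⟨x.1, x.2.1.2.2, x.2.2⟩⟩
  invFun x := ⟨x.2.2.1, ⟨x.1, x.2.1, x.2.2.2.1⟩, x.2.2.2.2⟩
  left_inv _ := rfl
  right_inv _ := rfl

/-- The associator. -/
def assoc (R : SetMat m n) (S : SetMat n p) (T : SetMat p q) :
    (R.mul S).mul T ≅ R.mul (S.mul T) := permIso fun l j => (assocE R S T l j).symm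

/-- The left unit bijection. -/
def lunitE (R : SetMat m n) (i j) : ((one m).mul R).E i j ≃ R.E i j where
  toFun x := x.2.2.down ▸ x.2.1
  invFun x := ⟨j, x, ⟨rfl⟩⟩
  left_inv x := by rcases x with ⟨k, x, ⟨rfl⟩⟩; rfl
  right_inv _ := rfl

/-- The right unit bijection. -/
def runitE (R : SetMat m n) (i j) : (R.mul (one n)).E i j ≃ R.E i j where
  toFun x := x.2.1.down.symm ▸ x.2.2
  invFun x := ⟨i, ⟨rfl⟩, x⟩
  left_inv x := by rcases x with ⟨k, ⟨rfl⟩, x⟩; rfl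
  right_inv _ := rfl

/-- The left unitor. -/
def lunit (R : SetMat m n) : (one m).mul R ≅ R := permIso (lunitE R)
/-- The right unitor. -/
def runit (R : SetMat m n) : R.mul (one n) ≅ R := permIso (runitE R)

theorem permIso_hom_app {R S : SetMat m n} (σ : ∀ i j, R.E i j ≃ S.E i j) (i j) :
    (permIso σ).hom i j = permMat (σ i j) := rfl

theorem comp_permIso_eq_iff {R S R' S' : SetMat m n} (σ : ∀ i j, R.E i j ≃ S.E i j)
    (τ : ∀ i j, R'.E i j ≃ S'.E i j) (f : R ⟶ R') (g : S ⟶ S')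
    (h : ∀ i j x y, f i j x y = g i j (τ i j x) (σ i j y)) :
    f = (permIso σ).hom ≫ g ≫ (permIso τ).inv := by
  refine hom_ext fun i j => ?_
  change f i j = (permMat (τ i j).symm * g i j) * permMat (σ i j)
  rw [permMat_mul, mul_permMat]
  ext x y
  simp [h]

theorem perm_inv_eq {R S R' S' : SetMat m n} (σ : ∀ i j, S.E i j ≃ R.E i j)
    (τ : ∀ i j, S'.E i j ≃ R'.E i j) (f : R ⟶ R') (g : S ⟶ S')
    (h : ∀ i j x y, f i j (τ i j x) (σ i j y) = g i j x y) :
    f = (permIso σ).inv ≫ g ≫ (permIso τ).hom := by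
  refine hom_ext fun i j => ?_
  change f i j = (permMat (τ i j) * g i j) * permMat (σ i j).symm
  rw [permMat_mul, mul_permMat]
  ext x y
  simp [← h]

theorem wl_permIso (R : SetMat m n) {S T : SetMat n p} (σ : ∀ i j, S.E i j ≃ T.E i j) :
    wl R (permIso σ).hom =
      (permIso (R := R.mul S) (S := R.mul T) fun k j => Equiv.sigmaCongrRight fun i =>
        (σ k i).prodCongr (Equiv.refl (R.E i j))).hom := by
  refine hom_ext fun k j => ?_
  simp only [wl, permIso_hom_app, permMat_kronecker_one]
  exact blockDiagonal'_permMat _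

theorem wr_permIso {R S : SetMat m n} (σ : ∀ i j, R.E i j ≃ S.E i j) (T : SetMat n p) :
    wr (permIso σ).hom T =
      (permIso (R := R.mul T) (S := S.mul T) fun k j => Equiv.sigmaCongrRight fun i =>
        (Equiv.refl (T.E k i)).prodCongr (σ i j)).hom := by
  refine hom_ext fun k j => ?_
  simp only [wr, permIso_hom_app, permMat_one_kronecker]
  exact blockDiagonal'_permMat _

theorem permIso_trans {R S T : SetMat m n} (σ : ∀ i j, R.E i j ≃ S.E i j)
    (τ : ∀ i j, S.E i j ≃ T.E i j) :
    (permIso σ).hom ≫ (permIso τ).hom = (permIso fun i j => (σ i j).trans (τ i j)).hom :=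
  hom_ext fun i j => permMat_mul_permMat (σ i j) (τ i j)

end SetMat

/-- The objects of the auxiliary bicategory. -/
structure SetMatObj where
  rank : ℕ

open SetMat

instance : Bicategory SetMatObj where
  Hom a b := SetMat a.rank b.rank
  id a := one a.rank
  comp R S := R.mul S
  homCategory a b := inferInstanceAs (Category (SetMat a.rank b.rank))
  whiskerLeft R _ _ T := wl R T
  whiskerRight T S := wr T S
  associator R S T := SetMat.assoc R S T
  leftUnitor R := lunit R
  rightUnitor R := runit R
  whiskerLeft_id := wl_id
  whiskerLeft_comp R _ _ _ f g := wl_comp R f g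
  id_whiskerRight := wr_id
  comp_whiskerRight f g S := wr_comp f g S
  whisker_exchange f g := exchange f g
  id_whiskerLeft {a b f g} η := by
    refine comp_permIso_eq_iff _ _ _ _ ?_
    rintro i j ⟨k, x, ⟨rfl⟩⟩ ⟨k', y, ⟨rfl⟩⟩
    change _ = η _ _ x y
    simp [wl]
  whiskerRight_id {a b f g} η := by
    refine comp_permIso_eq_iff _ _ _ _ ?_
    rintro i j ⟨k, ⟨rfl⟩, x⟩ ⟨k', ⟨rfl⟩, y⟩
    change _ = η _ _ x y
    simp [wr]
  comp_whiskerLeft f g _ _ η := by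
    refine comp_permIso_eq_iff _ _ _ _ ?_
    rintro i j ⟨k, x, k', y, z⟩ ⟨l, x', l', y', z'⟩
    change wl (f.mul g) η i j ⟨k, x, k', y, z⟩ ⟨l, x', l', y', z'⟩ =
      wl f (wl g η) i j ⟨k', ⟨k, x, y⟩, z⟩ ⟨l', ⟨l, x', y'⟩, z'⟩
    by_cases h : k = l
    · subst h
      by_cases h' : k' = l'
      · subst h'
        simp [wl, Matrix.one_apply, ite_and, -mul_ite, mul_assoc]
      · simp [wl, Matrix.one_apply, Matrix.blockDiagonal'_apply, h']
    · by_cases h' : k' = l'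
      · subst h'
        simp [wl, Matrix.blockDiagonal'_apply, h]
      · simp [wl, Matrix.blockDiagonal'_apply, h, h']
  whiskerRight_comp η g h := by
    refine perm_inv_eq _ _ _ _ ?_
    rintro i j ⟨k, x, k', y, z⟩ ⟨l, x', l', y', z'⟩
    change wr η (g.mul h) i j ⟨k', ⟨k, x, y⟩, z⟩ ⟨l', ⟨l, x', y'⟩, z'⟩ =
      wr (wr η g) h i j ⟨k, x, k', y, z⟩ ⟨l, x', l', y', z'⟩
    by_cases h : k = l
    · subst h
      by_cases h' : k' = l'
      · subst h'
        simp [wr, Matrix.one_apply]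
        grind
      · simp [wr, Matrix.blockDiagonal'_apply, h']
    · by_cases h' : k' = l'
      · subst h'
        simp [wr, Matrix.one_apply, Matrix.blockDiagonal'_apply, h]
      · simp [wr, Matrix.one_apply, Matrix.blockDiagonal'_apply, h, h']
  whisker_assoc f _ _ η h := by
    refine comp_permIso_eq_iff _ _ _ _ ?_
    rintro i j ⟨k, x, k', y, z⟩ ⟨l, x', l', y', z'⟩
    change wr (wl f η) h i j ⟨k, x, k', y, z⟩ ⟨l, x', l', y', z'⟩ =
      wl f (wr η h) i j ⟨k', ⟨k, x, y⟩, z⟩ ⟨l', ⟨l, x', y'⟩, z'⟩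
    by_cases h : k = l
    · subst h
      by_cases h' : k' = l'
      · subst h'
        simp [wr, wl, mul_assoc]
      · simp [wr, wl, Matrix.blockDiagonal'_apply, h']
    · by_cases h' : k' = l'
      · subst h'
        simp [wr, wl, Matrix.blockDiagonal'_apply, h]
      · simp [wr, wl, Matrix.blockDiagonal'_apply, h, h']
  pentagon f g h i := by
    change wr (permIso _).hom _ ≫ (permIso _).hom ≫ wl _ (permIso _).hom =
      (permIso _).hom ≫ (permIso _).hom
    rw [wr_permIso, wl_permIso, permIso_trans, permIso_trans, permIso_trans]
    rfl
  triangle f g := by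
    change (permIso _).hom ≫ wl _ (permIso _).hom = wr (permIso _).hom _
    rw [wr_permIso, wl_permIso, permIso_trans]
    congr 2
    funext i j
    refine Equiv.ext ?_
    rintro ⟨k, x, k', ⟨rfl⟩, z⟩
    rfl

section transport
open Bicategory

universe u' v' w v u

/-- Data for transporting a bicategory structure along a map on objects and 1-morphisms which
preserves identities and composition up to isomorphism. -/
structure BicatTransport (W : Type u) [Bicategory.{w, v} W] (X : Type u') where
  Hom₁ : X → X → Type v'
  obj : X → W
  map : ∀ {x y}, Hom₁ x y → (obj x ⟶ obj y)
  one : ∀ x, Hom₁ x x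
  comp : ∀ {x y z}, Hom₁ x y → Hom₁ y z → Hom₁ x z
  oneIso : ∀ x, 𝟙 (obj x) ≅ map (one x)
  compIso : ∀ {x y z} (f : Hom₁ x y) (g : Hom₁ y z), map f ≫ map g ≅ map (comp f g)

namespace BicatTransport
variable {W : Type u} [Bicategory.{w, v} W]
variable {X : Type u'} (D : BicatTransport.{u', v', w, v, u} W X)

/-- The 2-morphisms are those of `W`. -/
abbrev homCat (x y : X) : Category.{w} (D.Hom₁ x y) where
  Hom f g := D.map f ⟶ D.map g
  id f := 𝟙 (D.map f)
  comp η θ := η ≫ θ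

/-- Transported whiskering. -/
abbrev wL {x y z : X} (f : D.Hom₁ x y) {g h : D.Hom₁ y z} (η : D.map g ⟶ D.map h) :
    D.map (D.comp f g) ⟶ D.map (D.comp f h) :=
  (D.compIso f g).inv ≫ D.map f ◁ η ≫ (D.compIso f h).hom

/-- Transported whiskering. -/
abbrev wR {x y z : X} {f g : D.Hom₁ x y} (η : D.map f ⟶ D.map g) (h : D.Hom₁ y z) :
    D.map (D.comp f h) ⟶ D.map (D.comp g h) :=
  (D.compIso f h).inv ≫ η ▷ D.map h ≫ (D.compIso g h).hom

/-- The transported associator. -/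
abbrev assoc {w x y z : X} (f : D.Hom₁ w x) (g : D.Hom₁ x y) (h : D.Hom₁ y z) :
    D.map (D.comp (D.comp f g) h) ≅ D.map (D.comp f (D.comp g h)) :=
  (D.compIso (D.comp f g) h).symm ≪≫ whiskerRightIso (D.compIso f g).symm (D.map h) ≪≫
      α_ (D.map f) (D.map g) (D.map h) ≪≫ whiskerLeftIso (D.map f) (D.compIso g h) ≪≫
      D.compIso f (D.comp g h)

/-- A transported unitor. -/
abbrev lunit {x y : X} (f : D.Hom₁ x y) : D.map (D.comp (D.one x) f) ≅ D.map f :=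
  (D.compIso (D.one x) f).symm ≪≫ whiskerRightIso (D.oneIso x).symm (D.map f) ≪≫ λ_ (D.map f)

/-- A transported unitor. -/
abbrev runit {x y : X} (f : D.Hom₁ x y) : D.map (D.comp f (D.one y)) ≅ D.map f :=
  (D.compIso f (D.one y)).symm ≪≫ whiskerLeftIso (D.map f) (D.oneIso y).symm ≪≫ ρ_ (D.map f)

theorem wL_id {x y z : X} (f : D.Hom₁ x y) (g : D.Hom₁ y z) :
    D.wL f (𝟙 (D.map g)) = 𝟙 _ := by
  rw [wL, Bicategory.whiskerLeft_id, Category.id_comp, Iso.inv_hom_id]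

theorem wR_id {x y z : X} (f : D.Hom₁ x y) (g : D.Hom₁ y z) :
    D.wR (𝟙 (D.map f)) g = 𝟙 _ := by
  rw [wR, Bicategory.id_whiskerRight, Category.id_comp, Iso.inv_hom_id]

theorem wL_one {x y : X} {f g : D.Hom₁ x y} (η : D.map f ⟶ D.map g) :
    D.wL (D.one x) η = (D.lunit f).hom ≫ η ≫ (D.lunit g).inv := by
  have := whisker_exchange_assoc (D.oneIso x).inv η
    ((D.oneIso x).hom ▷ _ ≫ (D.compIso (D.one x) g).hom)
  simp at this
  simp [this]

theorem wR_one {x y : X} {f g : D.Hom₁ x y} (η : D.map f ⟶ D.map g) :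
    D.wR η (D.one y) = (D.runit f).hom ≫ η ≫ (D.runit g).inv := by
  have := whisker_exchange_assoc η (D.oneIso y).inv
    (_ ◁ (D.oneIso y).hom ≫ (D.compIso g (D.one y)).hom)
  simp at this
  simp [← this]

theorem wL_comp {w x y z : X} (f : D.Hom₁ w x) (g : D.Hom₁ x y) {h h' : D.Hom₁ y z}
    (η : D.map h ⟶ D.map h') :
    D.wL (D.comp f g) η = (D.assoc f g h).hom ≫ D.wL f (D.wL g η) ≫ (D.assoc f g h').inv := by
  have := whisker_exchange_assoc (D.compIso f g).inv η
    ((D.compIso f g).hom ▷ _ ≫ (D.compIso (D.comp f g) h').hom)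
  simp at this
  simp [this]

theorem wR_comp {w x y z : X} {f f' : D.Hom₁ w x} (η : D.map f ⟶ D.map f') (g : D.Hom₁ x y)
    (h : D.Hom₁ y z) :
    D.wR η (D.comp g h) = (D.assoc f g h).inv ≫ D.wR (D.wR η g) h ≫ (D.assoc f' g h).hom := by
  have := whisker_exchange_assoc η (D.compIso g h).inv
    (_ ◁ (D.compIso g h).hom ≫ (D.compIso f' (D.comp g h)).hom)
  simp at this
  simp [← this]

attribute [local instance] homCat

/-- An isomorphism of images, regarded as an isomorphism. -/
abbrev mkIso {x y : X} {f g : D.Hom₁ x y} (i : D.map f ≅ D.map g) : f ≅ g :=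
  ⟨i.hom, i.inv, i.hom_inv_id, i.inv_hom_id⟩

/-- The transported bicategory. -/
abbrev bicategory : Bicategory.{w, v'} X where
  Hom x y := D.Hom₁ x y
  id x := D.one x
  comp f g := D.comp f g
  homCategory x y := D.homCat x y
  whiskerLeft f _ _ η := D.wL f η
  whiskerRight η h := D.wR η h
  associator f g h := D.mkIso (D.assoc f g h)
  leftUnitor f := D.mkIso (D.lunit f)
  rightUnitor f := D.mkIso (D.runit f)
  whiskerLeft_id f g := by
    change D.wL f (𝟙 (D.map g)) = 𝟙 (D.map _)
    exact D.wL_id f g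
  whiskerLeft_comp {x y z} f g h i η θ := by
    change D.wL f (CategoryStruct.comp (obj := (D.obj y ⟶ D.obj z)) η θ) =
      (CategoryStruct.comp (obj := (D.obj x ⟶ D.obj z)) (D.wL f η) (D.wL f θ))
    simp
  id_whiskerRight f g := by
    change D.wR (𝟙 (D.map f)) g = 𝟙 (D.map _)
    exact D.wR_id f g
  comp_whiskerRight {x y z f g i} η θ h := by
    change D.wR (CategoryStruct.comp (obj := (D.obj x ⟶ D.obj y)) η θ) h =
      (CategoryStruct.comp (obj := (D.obj x ⟶ D.obj z)) (D.wR η h) (D.wR θ h))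
    simp
  id_whiskerLeft {x y f g} η := by
    change D.wL (D.one x) (η : D.map f ⟶ D.map g) = (D.lunit f).hom ≫
      ((η : D.map f ⟶ D.map g) ≫ (D.lunit g).inv : D.map f ⟶ D.map (D.comp (D.one x) g))
    exact D.wL_one η
  whiskerRight_id {x y f g} η := by
    change D.wR (η : D.map f ⟶ D.map g) (D.one y) = (D.runit f).hom ≫
      ((η : D.map f ⟶ D.map g) ≫ (D.runit g).inv : D.map f ⟶ D.map (D.comp g (D.one y)))
    exact D.wR_one η
  comp_whiskerLeft {w x y z} f g h h' η := by
    change D.wL (D.comp f g) (η : D.map h ⟶ D.map h') = (D.assoc f g h).hom ≫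
      (D.wL f (D.wL g (η : D.map h ⟶ D.map h')) ≫ (D.assoc f g h').inv :
        _ ⟶ D.map (D.comp (D.comp f g) h'))
    exact D.wL_comp f g η
  whiskerRight_comp {w x y z f f'} η g h := by
    change D.wR (η : D.map f ⟶ D.map f') (D.comp g h) = (D.assoc f g h).inv ≫
      (D.wR (D.wR (η : D.map f ⟶ D.map f') g) h ≫ (D.assoc f' g h).hom :
        _ ⟶ D.map (D.comp f' (D.comp g h)))
    exact D.wR_comp η g h
  whisker_assoc {w x y z} f g g' η h := by
    change D.wR (D.wL f (η : D.map g ⟶ D.map g')) h = (D.assoc f g h).hom ≫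
      (D.wL f (D.wR (η : D.map g ⟶ D.map g') h) ≫ (D.assoc f g' h).inv :
        _ ⟶ D.map (D.comp (D.comp f g') h))
    simp
  whisker_exchange {x y z f g h i} η θ := by
    change (CategoryStruct.comp (obj := (D.obj x ⟶ D.obj z)) (D.wL f θ) (D.wR η i)) =
      (CategoryStruct.comp (obj := (D.obj x ⟶ D.obj z)) (D.wR η h) (D.wL g θ))
    simp [whisker_exchange_assoc]
  pentagon {a b c d e} f g h i := by
    change (CategoryStruct.comp (obj := (D.obj a ⟶ D.obj e)) (D.wR (D.assoc f g h).hom i)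
      (CategoryStruct.comp (obj := (D.obj a ⟶ D.obj e)) (D.assoc f (D.comp g h) i).hom
        (D.wL f (D.assoc g h i).hom))) =
      (CategoryStruct.comp (obj := (D.obj a ⟶ D.obj e)) (D.assoc (D.comp f g) h i).hom
        (D.assoc f g (D.comp h i)).hom)
    simp [whisker_exchange_assoc]
  triangle {a b c} f g := by
    change (CategoryStruct.comp (obj := (D.obj a ⟶ D.obj c)) (D.assoc f (D.one b) g).hom
      (D.wL f (D.lunit g).hom)) = D.wR (D.runit f).hom g
    simp
end BicatTransport
end transport

section gl
variable {α β γ : Type} [Fintype α] [DecidableEq α] [Fintype β] [DecidableEq β]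
  [Fintype γ] [DecidableEq γ]

/-- Renaming of the indices of an invertible matrix along a bijection. -/
def reindexGL (e : α ≃ β) : GL α ℂ ≃* GL β ℂ :=
  Units.mapEquiv (Matrix.reindexAlgEquiv ℂ ℂ e).toMulEquiv

/-- The direct sum of invertible matrices. -/
def blockGL {ι : Type} [Fintype ι] [DecidableEq ι] {A : ι → Type} [∀ i, Fintype (A i)]
    [∀ i, DecidableEq (A i)] (M : ∀ i, GL (A i) ℂ) : GL (Σ i, A i) ℂ where
  val := Matrix.blockDiagonal' fun i => (M i : Matrix (A i) (A i) ℂ)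
  inv := Matrix.blockDiagonal' fun i => ((M i)⁻¹ : GL (A i) ℂ).val
  val_inv := by
    rw [← Matrix.blockDiagonal'_mul, ← Matrix.blockDiagonal'_one]
    congr 1; funext i; exact (M i).mul_inv
  inv_val := by
    rw [← Matrix.blockDiagonal'_mul, ← Matrix.blockDiagonal'_one]
    congr 1; funext i; exact (M i).inv_mul

/-- The Kronecker product of invertible matrices. -/
def kronGL (M : GL α ℂ) (N : GL β ℂ) : GL (α × β) ℂ where
  val := M.val ⊗ₖ N.val
  inv := (M⁻¹).val ⊗ₖ (N⁻¹).val
  val_inv := by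
    rw [← Matrix.mul_kronecker_mul, ← Units.val_mul, ← Units.val_mul]; simp
  inv_val := by
    rw [← Matrix.mul_kronecker_mul, ← Units.val_mul, ← Units.val_mul]; simp

/-- A permutation matrix as an invertible matrix. -/
def permGL (σ : α ≃ α) : GL α ℂ where
  val := permMat σ
  inv := permMat σ.symm
  val_inv := by rw [permMat_mul_permMat, Equiv.symm_trans_self, permMat_refl]
  inv_val := by rw [permMat_mul_permMat, Equiv.self_trans_symm, permMat_refl]

theorem perm_gl_inv (σ : α ≃ β) (M : GL β ℂ) :
    (permMat σ.symm * (M⁻¹).val) * (M.val * permMat σ) = 1 := by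
  rw [Matrix.mul_assoc, ← Matrix.mul_assoc _ _ (permMat _), Units.inv_mul, Matrix.one_mul,
    permMat_mul_permMat, Equiv.self_trans_symm, permMat_refl]

theorem gl_perm_inv (σ : α ≃ β) (M : GL β ℂ) :
    (M.val * permMat σ) * (permMat σ.symm * (M⁻¹).val) = 1 := by
  rw [Matrix.mul_assoc, ← Matrix.mul_assoc (permMat _), permMat_mul_permMat,
    Equiv.symm_trans_self, permMat_refl, Matrix.one_mul, Units.mul_inv]

theorem permGL_refl : permGL (Equiv.refl α) = 1 := Units.ext permMat_refl

theorem kronGL_one_one : kronGL (1 : GL α ℂ) (1 : GL β ℂ) = 1 :=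
  Units.ext (Matrix.one_kronecker_one)

theorem blockGL_one {ι : Type} [Fintype ι] [DecidableEq ι] {A : ι → Type} [∀ i, Fintype (A i)]
    [∀ i, DecidableEq (A i)] : blockGL (fun i => (1 : GL (A i) ℂ)) = 1 :=
  Units.ext (Matrix.blockDiagonal'_one)

theorem reindexGL_apply (e : α ≃ β) (M : GL α ℂ) (x y : β) :
    (reindexGL e M).val x y = M.val (e.symm x) (e.symm y) := rfl

theorem reindexGL_trans (e : α ≃ β) (f : β ≃ γ) (M : GL α ℂ) :
    reindexGL f (reindexGL e M) = reindexGL (e.trans f) M := rfl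

end gl

/-- The number `∑ j, r j * a j`. -/
abbrev dot {n : ℕ} (r a : Fin n → ℕ) : ℕ := ∑ j, r j * a j

/-- The lexicographic enumeration of the index set of a direct sum `⨁ j, M j ⊗ N j`,
with `M j` of size `r j` and `N j` of size `a j`. -/
def blockEquiv {n : ℕ} (r a : Fin n → ℕ) : (Σ j, Fin (r j) × Fin (a j)) ≃ Fin (dot r a) :=
  (Equiv.sigmaCongrRight fun _ => finProdFinEquiv).trans finSigmaFinEquiv

theorem blockEquiv_val {n : ℕ} (r a : Fin n → ℕ) (j : Fin n) (p : Fin (r j)) (q : Fin (a j)) :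
    (blockEquiv r a ⟨j, p, q⟩ : ℕ) =
      (∑ i : Fin j, r (Fin.castLE j.2.le i) * a (Fin.castLE j.2.le i)) + (q + a j * p) := by
  simp [blockEquiv, finSigmaFinEquiv_apply]

theorem dot_single {n : ℕ} (r : Fin n → ℕ) (j : Fin n) : dot r (Pi.single j 1) = r j := by
  simp [dot, Pi.single_apply]

theorem eq_of_fin_single {n : ℕ} {j l : Fin n} (q : Fin ((Pi.single j 1 : Fin n → ℕ) l)) :
    l = j := by
  by_contra h
  have hq : (q : ℕ) < (Pi.single j 1 : Fin n → ℕ) l := q.2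
  have := Pi.single_eq_of_ne (M := fun _ => ℕ) h 1
  omega

theorem val_fin_single {n : ℕ} {j l : Fin n} (q : Fin ((Pi.single j 1 : Fin n → ℕ) l)) :
    (q : ℕ) = 0 := by
  obtain rfl := eq_of_fin_single q
  have hq : (q : ℕ) < (Pi.single l 1 : Fin n → ℕ) l := q.2
  have := Pi.single_eq_same (M := fun _ => ℕ) l 1
  omega

theorem blockEquiv_single_val {n : ℕ} (r : Fin n → ℕ) (j : Fin n) (p : Fin (r j))
    (q : Fin ((Pi.single j 1 : Fin n → ℕ) j)) :
    (blockEquiv r (Pi.single j 1) ⟨j, p, q⟩ : ℕ) = p := by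
  rw [blockEquiv_val, Finset.sum_eq_zero]
  · have hq := q.2
    simp only [Pi.single_eq_same] at hq ⊢
    omega
  · intro i _
    rw [Pi.single_eq_of_ne, mul_zero]
    intro h
    have := congrArg Fin.val h
    have h2 := i.2
    simp at this
    omega

/-- The objects of the bicategory of 2-matrices: the natural numbers. -/
structure TwoMat where
  rank : ℕ

/-- The 1-morphisms `n ⟶ m` of 2-matrices: an `m × n` matrix `R` of natural numbers (the rank
matrix), together with a gauge, that is, an invertible matrix `s a i` of size `∑ j, R i j * a j`
for all `a : ℕⁿ` and `i`, equal to the identity if `a` is a vector `e_j` of the canonical basis.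
If `n = 0` or `m = 0`, there is exactly one 1-morphism. -/
structure RankGauge (n m : ℕ) where
  R : Fin m → Fin n → ℕ
  s : ∀ (a : Fin n → ℕ) (i : Fin m), GL (Fin (dot (R i) a)) ℂ
  norm : ∀ (j : Fin n) (i : Fin m), s (Pi.single j 1) i = 1

namespace RankGauge

variable {n m p : ℕ}

/-- The distributivity bijection. -/
def distrib {α β : Type} {X : α → Type} {Y : α → β → Type} {Z : β → Type} :
    (Σ j, (Σ i, X i × Y i j) × Z j) ≃ Σ i, X i × Σ j, Y i j × Z j where
  toFun x := ⟨x.2.1.1, x.2.1.2.1, ⟨x.1, x.2.1.2.2, x.2.2⟩⟩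
  invFun x := ⟨x.2.2.1, ⟨x.1, x.2.1, x.2.2.2.1⟩, x.2.2.2.2⟩
  left_inv _ := rfl
  right_inv _ := rfl

theorem dot_comp (t : Fin m → ℕ) (R : Fin m → Fin n → ℕ) (a : Fin n → ℕ) :
    dot t (fun i => dot (R i) a) = dot (fun j => dot t fun i => R i j) a := by
  simp only [dot, Finset.mul_sum, Finset.sum_mul]
  rw [Finset.sum_comm]
  simp only [mul_assoc]

/-- The permutation of `Fin (dot (t R) a)` which interchanges the two canonical ways of enumerating
the index set of `⨁ i, ⨁ j, ℂ^(t i) ⊗ ℂ^(R i j) ⊗ ℂ^(a j)`: grouped first by `j`, or first by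
`i`. -/
def distribPerm (t : Fin m → ℕ) (R : Fin m → Fin n → ℕ) (a : Fin n → ℕ) :
    Fin (dot (fun j => dot t fun i => R i j) a) ≃ Fin (dot (fun j => dot t fun i => R i j) a) :=
  (blockEquiv (fun j => dot t fun i => R i j) a).symm.trans <|
  (Equiv.sigmaCongrRight fun j =>
    (blockEquiv t fun i => R i j).symm.prodCongr (Equiv.refl (Fin (a j)))).trans <|
  (distrib (X := fun i => Fin (t i)) (Y := fun i j => Fin (R i j)) (Z := fun j => Fin (a j))).trans <|
  (Equiv.sigmaCongrRight fun i => (Equiv.refl (Fin (t i))).prodCongr (blockEquiv (R i) a)).trans <|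
  (blockEquiv t fun i => dot (R i) a).trans (finCongr (dot_comp t R a))

/-- The gauge of the composite of `r : n ⟶ m` and `t : m ⟶ p`: up to renaming of indices, the
matrix indexed by `a` and `k` is the product
`t_k(R(a)) (⨁ i, 1 ⊗ r_i(a)) P (⨁ j, t_k(R(e_j))⁻¹ ⊗ 1)` with `P` the permutation matrix of the
canonical bijection `distribPerm`. -/
def compGauge (r : RankGauge n m) (t : RankGauge m p) (a : Fin n → ℕ) (k : Fin p) :
    GL (Fin (dot (fun j => dot (t.R k) fun i => r.R i j) a)) ℂ :=
  reindexGL (finCongr (dot_comp (t.R k) r.R a)) (t.s (fun i => dot (r.R i) a) k) *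
  reindexGL ((blockEquiv (t.R k) fun i => dot (r.R i) a).trans (finCongr (dot_comp (t.R k) r.R a)))
    (blockGL fun i => kronGL (1 : GL (Fin (t.R k i)) ℂ) (r.s a i)) *
  permGL (distribPerm (t.R k) r.R a) *
  reindexGL (blockEquiv (fun j => dot (t.R k) fun i => r.R i j) a)
    (blockGL fun j => kronGL (t.s (fun i => r.R i j) k)⁻¹ (1 : GL (Fin (a j)) ℂ))

theorem distribPerm_single (t : Fin m → ℕ) (R : Fin m → Fin n → ℕ) (j : Fin n) :
    distribPerm t R (Pi.single j 1) = Equiv.refl _ := by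
  refine Equiv.ext fun x => ?_
  obtain ⟨⟨l, x, q⟩, rfl⟩ := (blockEquiv (fun j => dot t fun i => R i j) _).surjective x
  obtain rfl := eq_of_fin_single q
  obtain ⟨⟨i, y, z⟩, rfl⟩ := (blockEquiv t fun i => R i l).surjective x
  refine Fin.ext ?_
  simp only [distribPerm, Equiv.trans_apply, Equiv.symm_apply_apply, Equiv.sigmaCongrRight_apply,
    Equiv.prodCongr_apply, Prod.map, Equiv.refl_apply, finCongr_apply, Fin.val_cast, distrib,
    Equiv.coe_fn_mk]
  rw [blockEquiv_single_val, blockEquiv_val, blockEquiv_val t, blockEquiv_single_val]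
  simp only [dot_single]

theorem blockGL_single (r : Fin n → ℕ) (j : Fin n) (M : ∀ j, GL (Fin (r j)) ℂ) :
    reindexGL (blockEquiv r (Pi.single j 1))
      (blockGL fun l => kronGL (M l) (1 : GL (Fin ((Pi.single j 1 : Fin n → ℕ) l)) ℂ)) =
    reindexGL (finCongr (dot_single r j).symm) (M j) := by
  refine Units.ext (Matrix.ext fun x y => ?_)
  obtain ⟨⟨l, x, q⟩, rfl⟩ := (blockEquiv r (Pi.single j 1)).surjective x
  obtain ⟨⟨l', y, q'⟩, rfl⟩ := (blockEquiv r (Pi.single j 1)).surjective y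
  obtain rfl := eq_of_fin_single q
  obtain rfl := eq_of_fin_single q'
  obtain rfl : q = q' := Fin.ext <| by
    rw [val_fin_single q, val_fin_single q']
  have hx : ∀ x : Fin (r l'), (finCongr (dot_single r l').symm).symm
      (blockEquiv r (Pi.single l' 1 : Fin n → ℕ) ⟨l', x, q⟩) = x := fun x => Fin.ext <|
    blockEquiv_single_val r l' x q
  rw [reindexGL_apply, reindexGL_apply, hx, hx, Equiv.symm_apply_apply, Equiv.symm_apply_apply]
  refine (Matrix.blockDiagonal'_apply_eq (fun l => (kronGL (M l)
    (1 : GL (Fin ((Pi.single l' 1 : Fin n → ℕ) l)) ℂ)).val) l' (x, q) (y, q)).trans ?_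
  simp [kronGL]

theorem reindexGL_mul_inv {N : ℕ} (r : Fin n → ℕ) (s : ∀ a : Fin n → ℕ, GL (Fin (dot r a)) ℂ)
    {b c : Fin n → ℕ} (h : b = c) (hb : dot r b = N) (hc : dot r c = N) :
    reindexGL (finCongr hb) (s b) * reindexGL (finCongr hc) (s c)⁻¹ = 1 := by
  subst h
  rw [← map_mul, mul_inv_cancel, map_one]

/-- The composition of 1-morphisms: the rank matrices are multiplied. -/
def comp (r : RankGauge n m) (t : RankGauge m p) : RankGauge n p where
  R k j := dot (t.R k) fun i => r.R i j
  s := compGauge r t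
  norm j k := by
    rw [compGauge]
    have h1 : (blockGL fun i => kronGL (1 : GL (Fin (t.R k i)) ℂ) (r.s (Pi.single j 1) i)) = 1 := by
      rw [← blockGL_one]
      congr 1
      funext i
      rw [r.norm, kronGL_one_one]
    rw [h1, map_one, mul_one, distribPerm_single, permGL_refl, mul_one,
      blockGL_single (fun j => dot (t.R k) fun i => r.R i j) j fun j => (t.s (fun i => r.R i j) k)⁻¹]
    exact reindexGL_mul_inv (t.R k) (fun b => t.s b k) (funext fun i => dot_single _ _) _ _

/-- The identity 1-morphism: the identity matrix with the trivial gauge. -/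
def one (n : ℕ) : RankGauge n n where
  R i j := if i = j then 1 else 0
  s _ _ := 1
  norm _ _ := rfl

/-- Forgetting the gauge and replacing numbers by finite sets. -/
abbrev toSetMat (r : RankGauge n m) : SetMat n m where
  E i j := Fin (r.R i j)

/-- The comparison between the block index set and its enumeration, corrected by the gauge. -/
def compHom (r : RankGauge n m) (t : RankGauge m p) :
    r.toSetMat.mul t.toSetMat ⟶ (r.comp t).toSetMat :=
  fun k j => (t.s (fun i => r.R i j) k).val * permMat (blockEquiv (t.R k) fun i => r.R i j)

/-- The inverse of `compHom`. -/
def compInv (r : RankGauge n m) (t : RankGauge m p) :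
    (r.comp t).toSetMat ⟶ r.toSetMat.mul t.toSetMat :=
  fun k j => permMat (blockEquiv (t.R k) fun i => r.R i j).symm *
    ((t.s (fun i => r.R i j) k)⁻¹).val

/-- The isomorphism `compHom`. -/
def compIso (r : RankGauge n m) (t : RankGauge m p) :
    r.toSetMat.mul t.toSetMat ≅ (r.comp t).toSetMat where
  hom := compHom r t
  inv := compInv r t
  hom_inv_id := by
    refine SetMat.hom_ext fun k j => ?_
    exact perm_gl_inv _ _
  inv_hom_id := by
    refine SetMat.hom_ext fun k j => ?_
    exact gl_perm_inv _ _

/-- The `(i, j)` entry of an identity 1-morphism. -/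
def oneEquiv (i j : Fin n) : PLift (i = j) ≃ Fin (if i = j then 1 else 0) where
  toFun h := ⟨0, by rw [if_pos h.down]; exact one_pos⟩
  invFun x := ⟨by
    by_contra h
    have hx : (x : ℕ) < if i = j then 1 else 0 := x.2
    have : (if i = j then 1 else 0) = 0 := if_neg h
    omega⟩
  left_inv _ := rfl
  right_inv x := Fin.ext <| by
    have hx : (x : ℕ) < if i = j then 1 else 0 := x.2
    have : (if i = j then 1 else 0) ≤ 1 := by split_ifs <;> omega
    dsimp
    omega

/-- The comparison isomorphism for identities. -/
def oneIso (n : ℕ) : SetMat.one n ≅ (one n).toSetMat :=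
  SetMat.permIso oneEquiv

end RankGauge

/-- The bicategory of (complex) 2-matrices. The 2-morphisms `r ⟶ r'` are the matrices `T` whose
entry `T i j` is a complex matrix of size `r'.R i j × r.R i j`, the vertical composition is the
entrywise product, the horizontal composition is given by `whiskerLeft_entry` and
`whiskerRight_entry` below, and the entries of the associators are identity matrices
(`associator_entry`). -/
instance : Bicategory TwoMat :=
  BicatTransport.bicategory (W := SetMatObj)
    { Hom₁ := fun n m => RankGauge n.rank m.rank
      obj := fun n => ⟨n.rank⟩
      map := fun r => r.toSetMat
      one := fun n => RankGauge.one n.rank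
      comp := fun r t => r.comp t
      oneIso := fun n => RankGauge.oneIso n.rank
      compIso := fun r t => RankGauge.compIso r t }

theorem whiskerLeft_entry {n m p : TwoMat} (r : n ⟶ m) {t t' : m ⟶ p} (T : t ⟶ t') (k j) :
    Bicategory.whiskerLeft r T k j =
      ((t'.s (fun i => r.R i j) k).val * permMat (blockEquiv (t'.R k) fun i => r.R i j)) *
        Matrix.blockDiagonal' (fun i => T k i ⊗ₖ (1 : Matrix (Fin (r.R i j)) (Fin (r.R i j)) ℂ)) *
        (permMat (blockEquiv (t.R k) fun i => r.R i j).symm *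
          ((t.s (fun i => r.R i j) k)⁻¹).val) := rfl

theorem whiskerRight_entry {n m p : TwoMat} {r r' : n ⟶ m} (T : r ⟶ r') (t : m ⟶ p) (k j) :
    Bicategory.whiskerRight T t k j =
      ((t.s (fun i => r'.R i j) k).val * permMat (blockEquiv (t.R k) fun i => r'.R i j)) *
        Matrix.blockDiagonal' (fun i => (1 : Matrix (Fin (t.R k i)) (Fin (t.R k i)) ℂ) ⊗ₖ T i j) *
        (permMat (blockEquiv (t.R k) fun i => r.R i j).symm *
          ((t.s (fun i => r.R i j) k)⁻¹).val) := rfl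

theorem reindexGL_val {X Y : Type} [Fintype X] [DecidableEq X] [Fintype Y] [DecidableEq Y]
    (e : X ≃ Y) (U : GL X ℂ) : (reindexGL e U).val = permMat e * U.val * permMat e.symm := by
  rw [permMat_mul, mul_permMat]; rfl

theorem assoc_aux {X Y K K' Z Z' : Type} [Fintype X] [DecidableEq X] [Fintype Y] [DecidableEq Y]
    [Fintype K] [DecidableEq K] [Fintype K'] [DecidableEq K'] [Fintype Z] [DecidableEq Z]
    [Fintype Z'] [DecidableEq Z'] (e : X ≃ Y) (U : GL X ℂ) (E2 : K ≃ X) (Bt : GL K ℂ) (E1 : Z ≃ Y)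
    (B : GL Z ℂ) (σ1 : Z' ≃ Z) (α : K' ≃ Z') (σ2 : K' ≃ K) (Q : Y ≃ Y)
    (hQ : Q = E1.symm.trans (σ1.symm.trans (α.symm.trans (σ2.trans (E2.trans e))))) :
    (((((reindexGL e U * reindexGL (E2.trans e) Bt * permGL Q * reindexGL E1 B⁻¹).val * permMat E1) *
      (B.val * permMat σ1)) * permMat α) * (permMat σ2.symm * (Bt⁻¹).val)) *
      (permMat E2.symm * (U⁻¹).val) = permMat e := by
  have h1 : (permGL Q).val = permMat Q := rfl
  have c1 : permMat E1.symm * permMat E1 = (1 : Matrix Z Z ℂ) := by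
    rw [permMat_mul_permMat, Equiv.self_trans_symm, permMat_refl]
  have hp : permMat (E2.trans e).symm * permMat Q * permMat E1 * permMat σ1 * permMat α *
      permMat σ2.symm = 1 := by
    simp only [permMat_mul_permMat, hQ]
    rw [← permMat_refl]
    congr 1
    ext x
    simp
  calc _ = permMat e * U.val * (permMat e.symm * permMat (E2.trans e)) * Bt.val *
        (permMat (E2.trans e).symm * permMat Q * permMat E1 * ((B⁻¹).val *
          ((permMat E1.symm * permMat E1)) * B.val) * permMat σ1 * permMat α *
        permMat σ2.symm) * (Bt⁻¹).val * permMat E2.symm * (U⁻¹).val := by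
        simp only [Units.val_mul, reindexGL_val, h1, Matrix.mul_assoc]
    _ = permMat e := by
        rw [c1, Matrix.mul_one, Units.inv_mul, Matrix.mul_one, hp, Matrix.mul_one,
          Matrix.mul_assoc _ Bt.val, Units.mul_inv, Matrix.mul_one, permMat_mul_permMat,
          Matrix.mul_assoc _ _ (permMat E2.symm), permMat_mul_permMat]
        have : E2.symm.trans ((E2.trans e).trans e.symm) = Equiv.refl _ := by ext; simp
        rw [this, permMat_refl, Matrix.mul_one, Matrix.mul_assoc, Units.mul_inv, Matrix.mul_one]

theorem associator_entry {a b c d : TwoMat} (r : a ⟶ b) (t : b ⟶ c) (u : c ⟶ d) (l j) :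
    (Bicategory.associator r t u).hom l j =
      permMat (finCongr (RankGauge.dot_comp (u.R l) t.R fun i => r.R i j)) := by
  have hwl : SetMat.wl r.toSetMat (RankGauge.compHom t u) l j =
      (blockGL fun i => kronGL (u.s (fun k => t.R k i) l) (1 : GL (Fin (r.R i j)) ℂ)).val *
      permMat (Equiv.sigmaCongrRight fun i =>
        (blockEquiv (u.R l) fun k => t.R k i).prodCongr (Equiv.refl (Fin (r.R i j)))) := by
    rw [← blockDiagonal'_permMat]
    refine Eq.trans ?_ (Matrix.blockDiagonal'_mul _ _)
    simp only [← permMat_kronecker_one]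
    refine congrArg Matrix.blockDiagonal' (funext fun i => ?_)
    refine Eq.trans ?_ (Matrix.mul_kronecker_mul _ _ _ _)
    rw [Units.val_one, Matrix.mul_one]; rfl
  have hwr : SetMat.wr (RankGauge.compInv r t) u.toSetMat l j =
      permMat (Equiv.sigmaCongrRight fun k => (Equiv.refl (Fin (u.R l k))).prodCongr
        (blockEquiv (t.R k) fun i => r.R i j)).symm *
      ((blockGL fun k => kronGL (1 : GL (Fin (u.R l k)) ℂ) (t.s (fun i => r.R i j) k))⁻¹).val := by
    change _ = permMat (Equiv.sigmaCongrRight fun k => (Equiv.refl (Fin (u.R l k))).prodCongr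
        (blockEquiv (t.R k) fun i => r.R i j).symm) * _
    rw [← blockDiagonal'_permMat]
    refine Eq.trans ?_ (Matrix.blockDiagonal'_mul _ _)
    simp only [← permMat_one_kronecker]
    refine congrArg Matrix.blockDiagonal' (funext fun i => ?_)
    refine Eq.trans ?_ (Matrix.mul_kronecker_mul _ _ _ _)
    rw [inv_one, Units.val_one, Matrix.mul_one]; rfl
  have key := assoc_aux (finCongr (RankGauge.dot_comp (u.R l) t.R fun i => r.R i j))
    (u.s (fun k => dot (t.R k) fun i => r.R i j) l)
    (blockEquiv (u.R l) fun k => dot (t.R k) fun i => r.R i j)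
    (blockGL fun k => kronGL (1 : GL (Fin (u.R l k)) ℂ) (t.s (fun i => r.R i j) k))
    (blockEquiv (fun i => dot (u.R l) fun k => t.R k i) fun i => r.R i j)
    (blockGL fun i => kronGL (u.s (fun k => t.R k i) l) (1 : GL (Fin (r.R i j)) ℂ))
    (Equiv.sigmaCongrRight fun i =>
        (blockEquiv (u.R l) fun k => t.R k i).prodCongr (Equiv.refl (Fin (r.R i j))))
    (SetMat.assocE r.toSetMat t.toSetMat u.toSetMat l j).symm
    (Equiv.sigmaCongrRight fun k => (Equiv.refl (Fin (u.R l k))).prodCongr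
        (blockEquiv (t.R k) fun i => r.R i j))
    (RankGauge.distribPerm (u.R l) t.R fun i => r.R i j) rfl
  rw [← key, ← hwl, ← hwr]
  have hg : (blockGL fun i => kronGL (u.s (fun k => t.R k i) l)
      (1 : GL (Fin (r.R i j)) ℂ))⁻¹ = blockGL fun i => kronGL (u.s (fun k => t.R k i) l)⁻¹
      (1 : GL (Fin (r.R i j)) ℂ) := by
    refine Units.ext ?_
    change Matrix.blockDiagonal' (fun i => ((u.s (fun k => t.R k i) l)⁻¹).val ⊗ₖ
      ((1 : GL (Fin (r.R i j)) ℂ)⁻¹).val) = Matrix.blockDiagonal' (fun i =>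
        ((u.s (fun k => t.R k i) l)⁻¹).val ⊗ₖ (1 : GL (Fin (r.R i j)) ℂ).val)
    simp only [inv_one]
  rw [hg]
  change ((((_ * _) * _) * _) * _) = _
  rfl

section TwoGroups
open MonoidalCategory
universe v u

/-- A 2-group: a monoidal groupoid all of whose objects are invertible up to isomorphism. -/
class IsTwoGroup (G : Type u) [Category.{v} G] [MonoidalCategory G] : Prop where
  isGroupoid : IsGroupoid G
  exists_inverse : ∀ A : G, ∃ B : G, Nonempty (A ⊗ B ≅ 𝟙_ G) ∧ Nonempty (B ⊗ A ≅ 𝟙_ G)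

attribute [instance] IsTwoGroup.isGroupoid

/-- A special 2-group: isomorphic objects are equal, the unitors are identities, and every object
is strictly invertible. -/
class IsSpecialTwoGroup (G : Type u) [Category.{v} G] [MonoidalCategory G] : Prop where
  isGroupoid : IsGroupoid G
  skeletal : ∀ A B : G, Nonempty (A ≅ B) → A = B
  leftUnitor_eq : ∀ A : G, ∃ h : 𝟙_ G ⊗ A = A, λ_ A = eqToIso h
  rightUnitor_eq : ∀ A : G, ∃ h : A ⊗ 𝟙_ G = A, ρ_ A = eqToIso h
  exists_strict_inverse : ∀ A : G, ∃ B : G, A ⊗ B = 𝟙_ G ∧ B ⊗ A = 𝟙_ G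

instance (G : Type u) [Category.{v} G] [MonoidalCategory G] [h : IsSpecialTwoGroup G] :
    IsTwoGroup G where
  isGroupoid := h.isGroupoid
  exists_inverse A := by
    obtain ⟨B, h₁, h₂⟩ := h.exists_strict_inverse A
    exact ⟨B, ⟨eqToIso h₁⟩, ⟨eqToIso h₂⟩⟩

section
variable {G : Type u} [Category.{v} G] [MonoidalCategory G] [IsTwoGroup G]

/-- `π₀`: the isomorphism classes of objects, with the product induced by `⊗`. -/
abbrev Pi0 (G : Type u) [Category.{v} G] [MonoidalCategory G] : Type u := Skeleton G

/-- `π₁`: the automorphisms of the unit object. -/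
abbrev Pi1 (G : Type u) [Category.{v} G] [MonoidalCategory G] : Type v := Aut (𝟙_ G)

theorem Pi0.exists_inv (x : Pi0 G) : ∃ y : Pi0 G, y * x = 1 := by
  obtain ⟨A, rfl⟩ : ∃ A : G, toSkeleton A = x := Quotient.exists_rep x
  obtain ⟨B, _, ⟨h⟩⟩ := IsTwoGroup.exists_inverse A
  refine ⟨toSkeleton B, ?_⟩
  rw [← Skeleton.toSkeleton_tensorObj, Skeleton.one_eq]
  exact Quotient.sound ⟨h⟩

instance : Group (Pi0 G) :=
  { (inferInstance : Monoid (Skeleton G)) with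
    inv := fun x => (Pi0.exists_inv x).choose
    inv_mul_cancel := fun x => (Pi0.exists_inv x).choose_spec }

instance (A : G) : (tensorRight A).IsEquivalence := by
  obtain ⟨B, ⟨h₁⟩, ⟨h₂⟩⟩ := IsTwoGroup.exists_inverse A
  exact (CategoryTheory.Equivalence.mk (tensorRight A) (tensorRight B)
    ((rightUnitorNatIso G).symm ≪≫ (tensoringRight G).mapIso h₁.symm ≪≫ tensorRightTensor A B)
    ((tensorRightTensor B A).symm ≪≫ (tensoringRight G).mapIso h₂ ≪≫ rightUnitorNatIso G)
    ).isEquivalence_functor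

instance (A : G) : (tensorLeft A).IsEquivalence := by
  obtain ⟨B, ⟨h₁⟩, ⟨h₂⟩⟩ := IsTwoGroup.exists_inverse A
  exact (CategoryTheory.Equivalence.mk (tensorLeft A) (tensorLeft B)
    ((leftUnitorNatIso G).symm ≪≫ (tensoringLeft G).mapIso h₂.symm ≪≫ tensorLeftTensor B A)
    ((tensorLeftTensor A B).symm ≪≫ (tensoringLeft G).mapIso h₁ ≪≫ leftUnitorNatIso G)
    ).isEquivalence_functor

/-- `γ_A : π₁ ≃ Aut A`, `γ_A(u) = l_A ∘ (u ⊗ id_A) ∘ l_A⁻¹`. -/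
def gamma (A : G) : Pi1 G ≃* Aut A :=
  ((Functor.FullyFaithful.ofFullyFaithful (tensorRight A)).autMulEquivOfFullyFaithful (𝟙_ G)).trans
    (λ_ A).conjAut

/-- `δ_A : π₁ ≃ Aut A`, `δ_A(u) = r_A ∘ (id_A ⊗ u) ∘ r_A⁻¹`. -/
def delta (A : G) : Pi1 G ≃* Aut A :=
  ((Functor.FullyFaithful.ofFullyFaithful (tensorLeft A)).autMulEquivOfFullyFaithful (𝟙_ G)).trans
    (ρ_ A).conjAut

theorem gamma_hom (A : G) (u : Pi1 G) : (gamma A u).hom = (λ_ A).inv ≫ u.hom ▷ A ≫ (λ_ A).hom :=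
  rfl

theorem delta_hom (A : G) (u : Pi1 G) : (delta A u).hom = (ρ_ A).inv ≫ A ◁ u.hom ≫ (ρ_ A).hom :=
  rfl

/-- The action of (the class of) an object `A` on `π₁`: `[A] · u = γ_A⁻¹(δ_A(u))`. -/
def act (A : G) (u : Pi1 G) : Pi1 G := (gamma A).symm (delta A u)

theorem gamma_tensor (A C : G) (u : Pi1 G) :
    (gamma (A ⊗ C) u).hom = (gamma A u).hom ▷ C := by
  rw [gamma_hom, gamma_hom]
  simp

theorem gamma_act (A : G) (u : Pi1 G) : gamma A (act A u) = delta A u :=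
  (gamma A).apply_symm_apply _

theorem gamma_tensor_act (C A : G) (v : Pi1 G) :
    (gamma (C ⊗ A) (act C v)).hom = C ◁ (gamma A v).hom := by
  rw [gamma_tensor, gamma_act, delta_hom, gamma_hom]
  simp only [comp_whiskerRight, whisker_assoc, MonoidalCategory.whiskerLeft_comp, Category.assoc]
  rw [← triangle]
  simp

end

section special
variable {S : Type u} [Category.{v} S] [MonoidalCategory S] [h : IsSpecialTwoGroup S]

theorem IsSpecialTwoGroup.eq_of_hom {A B : S} (f : A ⟶ B) : A = B :=
  haveI := h.isGroupoid
  h.skeletal A B ⟨asIso f⟩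

/-- A morphism of a special 2-group, regarded as an automorphism of its source. -/
def toAut {A B : S} (f : A ⟶ B) : Aut A :=
  haveI := h.isGroupoid
  asIso f ≪≫ eqToIso (IsSpecialTwoGroup.eq_of_hom f).symm

/-- The element `γ_A⁻¹(f)` of `π₁` corresponding to a morphism `f`. -/
def gammaInv {A B : S} (f : A ⟶ B) : Pi1 S := (gamma A).symm (toAut f)

/-- The distinguished 3-cocycle of a special 2-group: `α(A, B, C) = γ⁻¹(a_{A, B, C})`. -/
def assocCocycle (A B C : S) : Pi1 S := gammaInv (α_ A B C).hom

theorem toAut_hom {A : S} (f : A ⟶ A) : (toAut f).hom = f := by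
  simp [toAut]

theorem gammaInv_eq_iff {A : S} (f : A ⟶ A) (u : Pi1 S) :
    gammaInv f = u ↔ f = (gamma A u).hom := by
  rw [gammaInv, MulEquiv.symm_apply_eq]
  exact ⟨fun e => by rw [← e, toAut_hom], fun e => Iso.ext ((toAut_hom f).trans e)⟩

theorem gammaInv_eqToHom {A B : S} (e : A = B) : gammaInv (eqToHom e) = 1 := by
  subst e
  rw [gammaInv_eq_iff, map_one]
  rfl

theorem gammaInv_id (A : S) : gammaInv (𝟙 A) = 1 := gammaInv_eqToHom rfl

theorem gammaInv_comp {A B C : S} (f : A ⟶ B) (g : B ⟶ C) :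
    gammaInv (f ≫ g) = gammaInv g * gammaInv f := by
  obtain rfl := IsSpecialTwoGroup.eq_of_hom f
  obtain rfl := IsSpecialTwoGroup.eq_of_hom g
  rw [gammaInv_eq_iff, map_mul]
  change f ≫ g = (gamma A (gammaInv f)).hom ≫ (gamma A (gammaInv g)).hom
  rw [← (gammaInv_eq_iff f _).1 rfl, ← (gammaInv_eq_iff g _).1 rfl]

theorem gammaInv_whiskerRight {A B : S} (f : A ⟶ B) (C : S) :
    gammaInv (f ▷ C) = gammaInv f := by
  obtain rfl := IsSpecialTwoGroup.eq_of_hom f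
  rw [gammaInv_eq_iff, gamma_tensor, ← (gammaInv_eq_iff f _).1 rfl]

theorem gammaInv_whiskerLeft {A B : S} (C : S) (f : A ⟶ B) :
    gammaInv (C ◁ f) = act C (gammaInv f) := by
  obtain rfl := IsSpecialTwoGroup.eq_of_hom f
  rw [gammaInv_eq_iff, gamma_tensor_act, ← (gammaInv_eq_iff f _).1 rfl]

/-- The pairs `(β, c)`: a `π₀`-invariant character `β` of `π₁` and a normalized 2-cochain `c` of
`π₀` with values in the trivial module `ℂˣ` such that `∂c = β ∘ α`. -/
structure CharacterData (S : Type u) [Category.{v} S] [MonoidalCategory S]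
    [IsSpecialTwoGroup S] where
  β : Pi1 S →* ℂˣ
  invariant : ∀ (A : S) (u : Pi1 S), β (act A u) = β u
  c : Pi0 S → Pi0 S → ℂˣ
  one_left : ∀ g, c 1 g = 1
  one_right : ∀ g, c g 1 = 1
  coboundary : ∀ A B C : S,
    c (toSkeleton B) (toSkeleton C) * (c (toSkeleton A * toSkeleton B) (toSkeleton C))⁻¹ *
      c (toSkeleton A) (toSkeleton B * toSkeleton C) * (c (toSkeleton A) (toSkeleton B))⁻¹ =
    β (assocCocycle A B C)

end special
end TwoGroups

section Reps
open MonoidalCategory MonoidalOpposite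
universe v₁ u₁ v₂ u₂

/-- The one-object bicategory of a monoidal category `G`: the composition of 1-morphisms is
`g ∘ f = g ⊗ f`, that is, `f ≫ g = g ⊗ f`. -/
abbrev Deloop (G : Type u₁) [Category.{v₁} G] [MonoidalCategory G] := MonoidalSingleObj Gᴹᵒᵖ

/-- The scalar matrix `z` as a 2-morphism of the identity of the object `1`. -/
def scalarHom (z : ℂˣ) : 𝟙 (⟨1⟩ : TwoMat) ⟶ 𝟙 (⟨1⟩ : TwoMat) :=
  fun i j => (z : ℂ) • (1 : Matrix (Fin ((RankGauge.one 1).R i j)) (Fin ((RankGauge.one 1).R i j)) ℂ)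

theorem scalarHom_one : scalarHom 1 = 𝟙 _ := by
  funext i j
  exact one_smul _ _

theorem scalarHom_mul (z w : ℂˣ) : scalarHom (z * w) = scalarHom w ≫ scalarHom z := by
  funext i j
  change _ = ((z : ℂ) • (1 : Matrix (Fin ((RankGauge.one 1).R i j)) _ ℂ)) * ((w : ℂ) • 1)
  rw [Matrix.smul_mul, Matrix.one_mul, smul_smul]
  rfl

/-- The scalar automorphisms of the identity of the object `1`. -/
def scalarIso (z : ℂˣ) : 𝟙 (⟨1⟩ : TwoMat) ≅ 𝟙 (⟨1⟩ : TwoMat) where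
  hom := scalarHom z
  inv := scalarHom z⁻¹
  hom_inv_id := by rw [← scalarHom_mul, inv_mul_cancel, scalarHom_one]
  inv_hom_id := by rw [← scalarHom_mul, mul_inv_cancel, scalarHom_one]

/-- The pseudofunctor of one-object bicategories induced by a monoidal functor. -/
def deloopMap {G : Type u₁} [Category.{v₁} G] [MonoidalCategory G] {S : Type u₂} [Category.{v₂} S]
    [MonoidalCategory S] (E : G ⥤ S) [E.Monoidal] : Pseudofunctor (Deloop G) (Deloop S) where
  obj _ := MonoidalSingleObj.star Sᴹᵒᵖ
  map X := (mop (E.obj (unmop X)) : Sᴹᵒᵖ)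
  map₂ f := (E.map (Quiver.Hom.unmop f)).mop
  map₂_id _ := congrArg mop (E.map_id _)
  map₂_comp _ _ := congrArg mop (E.map_comp _ _)
  mapId _ := (Functor.Monoidal.εIso E).symm.mop
  mapComp X Y := (Functor.Monoidal.μIso E (unmop Y) (unmop X)).symm.mop
  map₂_whisker_left X _ _ f :=
    congrArg mop (Functor.Monoidal.map_whiskerRight E (Quiver.Hom.unmop f) (unmop X))
  map₂_whisker_right f X :=
    congrArg mop (Functor.Monoidal.map_whiskerLeft E (unmop X) (Quiver.Hom.unmop f))
  map₂_associator X Y Z :=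
    congrArg mop (Functor.Monoidal.map_associator_inv E (unmop Z) (unmop Y) (unmop X))
  map₂_left_unitor X := congrArg mop (Functor.Monoidal.map_rightUnitor E (unmop X))
  map₂_right_unitor X := congrArg mop (Functor.Monoidal.map_leftUnitor E (unmop X))

theorem unit_whiskerLeft {C : Type u₁} [Bicategory.{v₂, v₁} C] {X : C} (x : 𝟙 X ⟶ 𝟙 X) :
    Bicategory.whiskerLeft (𝟙 X) x =
      (Bicategory.leftUnitor (𝟙 X)).hom ≫ x ≫ (Bicategory.leftUnitor (𝟙 X)).inv :=
  Bicategory.id_whiskerLeft x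

theorem unit_whiskerRight {C : Type u₁} [Bicategory.{v₂, v₁} C] {X : C} (x : 𝟙 X ⟶ 𝟙 X) :
    Bicategory.whiskerRight x (𝟙 X) =
      (Bicategory.leftUnitor (𝟙 X)).hom ≫ x ≫ (Bicategory.leftUnitor (𝟙 X)).inv := by
  rw [Bicategory.whiskerRight_id, Bicategory.unitors_equal, Bicategory.unitors_inv_equal]

theorem unit_associator {C : Type u₁} [Bicategory.{v₂, v₁} C] {X : C} :
    (Bicategory.associator (𝟙 X) (𝟙 X) (𝟙 X)).hom =
      Bicategory.whiskerRight (Bicategory.leftUnitor (𝟙 X)).hom (𝟙 X) ≫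
        Bicategory.whiskerLeft (𝟙 X) (Bicategory.leftUnitor (𝟙 X)).inv := by
  have h := Bicategory.triangle (𝟙 X) (𝟙 X)
  rw [← Bicategory.unitors_equal] at h
  rw [← h, Category.assoc, ← Bicategory.whiskerLeft_comp, Iso.hom_inv_id,
    Bicategory.whiskerLeft_id, Category.comp_id]

/-- The isomorphism `𝟙 ≅ 𝟙 ≫ 𝟙` whose inverse is the scalar `z`. -/
def scalarComp (z : ℂˣ) : 𝟙 (⟨1⟩ : TwoMat) ≅ 𝟙 (⟨1⟩ : TwoMat) ≫ 𝟙 (⟨1⟩ : TwoMat) :=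
  (scalarIso z).symm ≪≫ (Bicategory.leftUnitor (𝟙 (⟨1⟩ : TwoMat))).symm

theorem scalarComp_hom (z : ℂˣ) :
    (scalarComp z).hom = scalarHom z⁻¹ ≫ (Bicategory.leftUnitor (𝟙 (⟨1⟩ : TwoMat))).inv := rfl

theorem scalarComp_inv (z : ℂˣ) :
    (scalarComp z).inv = (Bicategory.leftUnitor (𝟙 (⟨1⟩ : TwoMat))).hom ≫ scalarHom z := rfl

theorem scalarComp_whiskerLeft (b z : ℂˣ) :
    scalarHom b = (scalarComp z).hom ≫ Bicategory.whiskerLeft _ (scalarHom b) ≫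
      (scalarComp z).inv := by
  rw [unit_whiskerLeft, scalarComp_hom, scalarComp_inv]
  simp only [Category.assoc, Iso.inv_hom_id_assoc]
  rw [← scalarHom_mul, ← scalarHom_mul]
  congr 1
  rw [mul_right_comm, mul_inv_cancel, one_mul]

theorem scalarComp_whiskerRight (b z : ℂˣ) :
    scalarHom b = (scalarComp z).hom ≫ Bicategory.whiskerRight (scalarHom b) _ ≫
      (scalarComp z).inv := by
  rw [unit_whiskerRight, ← unit_whiskerLeft]
  exact scalarComp_whiskerLeft b z

theorem scalarComp_associator (b x y z w : ℂˣ) (h : b = x⁻¹ * y⁻¹ * z * w) :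
    scalarHom b = (scalarComp x).hom ≫ Bicategory.whiskerRight (scalarComp y).hom _ ≫
      (Bicategory.associator _ _ _).hom ≫ Bicategory.whiskerLeft _ (scalarComp z).inv ≫
        (scalarComp w).inv := by
  rw [unit_associator]
  simp only [scalarComp_hom, scalarComp_inv, Bicategory.whiskerLeft_comp,
    Bicategory.comp_whiskerRight, Category.assoc]
  rw [← Bicategory.comp_whiskerRight_assoc (Bicategory.leftUnitor _).inv, Iso.inv_hom_id,
    Bicategory.id_whiskerRight, Category.id_comp,
    ← Bicategory.whiskerLeft_comp_assoc _ (Bicategory.leftUnitor _).inv, Iso.inv_hom_id,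
    Bicategory.whiskerLeft_id, Category.id_comp, unit_whiskerLeft, unit_whiskerRight]
  simp only [Category.assoc, Iso.inv_hom_id_assoc]
  rw [← scalarHom_mul, ← scalarHom_mul, ← scalarHom_mul, h]
  congr 1
  simp only [mul_comm, mul_left_comm, mul_assoc]

theorem scalarComp_leftUnitor : 𝟙 _ = (scalarComp 1).hom ≫
    Bicategory.whiskerRight (𝟙 _) _ ≫ (Bicategory.leftUnitor (𝟙 (⟨1⟩ : TwoMat))).hom := by
  rw [scalarComp_hom, Bicategory.id_whiskerRight, Category.id_comp, Category.assoc, Iso.inv_hom_id,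
    inv_one, scalarHom_one, Category.comp_id]

theorem scalarComp_rightUnitor : 𝟙 _ = (scalarComp 1).hom ≫
    Bicategory.whiskerLeft _ (𝟙 _) ≫ (Bicategory.rightUnitor (𝟙 (⟨1⟩ : TwoMat))).hom := by
  rw [scalarComp_hom, Bicategory.whiskerLeft_id, Category.id_comp, Bicategory.unitors_equal.symm,
    Category.assoc, Iso.inv_hom_id, inv_one, scalarHom_one, Category.comp_id]

theorem coboundary_aux {M : Type} [CommGroup M] {a b c d t : M}
    (h : a * b⁻¹ * c * d⁻¹ = t⁻¹) : t = c⁻¹ * a⁻¹ * d * b := by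
  rw [← inv_inv t, ← h]
  simp only [_root_.mul_inv_rev, inv_inv, mul_comm, mul_left_comm, mul_assoc]

section special
variable {S : Type u₂} [Category.{v₂} S] [MonoidalCategory S] [IsSpecialTwoGroup S]

/-- The representation `I_{β,c}` of a special 2-group: every object acts on the object `1` by the
identity, a morphism `φ` acts by the scalar `β(γ⁻¹(φ))`, and the structural isomorphism
`F(A) ∘ F(B) ⟶ F(A ⊗ B)` is the scalar `c([A], [B])`. -/
def CharacterData.rep₀ (χ : CharacterData S) : Pseudofunctor (Deloop S) TwoMat where
  obj _ := ⟨1⟩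
  map _ := 𝟙 _
  map₂ f := scalarHom (χ.β (gammaInv (Quiver.Hom.unmop f)))
  map₂_id X := by
    change scalarHom (χ.β (gammaInv (𝟙 (unmop X)))) = _
    rw [gammaInv_id, map_one, scalarHom_one]
  map₂_comp f g := by
    change scalarHom (χ.β (gammaInv (Quiver.Hom.unmop f ≫ Quiver.Hom.unmop g))) = _
    rw [gammaInv_comp, map_mul, scalarHom_mul]
  mapId _ := Iso.refl _
  mapComp X Y := scalarComp (χ.c (toSkeleton (unmop Y)) (toSkeleton (unmop X)))
  map₂_whisker_left X Y Z f := by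
    have hYZ : toSkeleton (unmop Y) = toSkeleton (unmop Z) :=
      congrArg _ (IsSpecialTwoGroup.eq_of_hom (Quiver.Hom.unmop f))
    change scalarHom (χ.β (gammaInv (Quiver.Hom.unmop f ▷ unmop X))) = _
    rw [gammaInv_whiskerRight, hYZ]
    exact scalarComp_whiskerLeft _ _
  map₂_whisker_right {_ _ _ Y Z} f X := by
    have hYZ : toSkeleton (unmop Y) = toSkeleton (unmop Z) :=
      congrArg _ (IsSpecialTwoGroup.eq_of_hom (Quiver.Hom.unmop f))
    change scalarHom (χ.β (gammaInv (unmop X ◁ Quiver.Hom.unmop f))) = _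
    rw [gammaInv_whiskerLeft, χ.invariant, hYZ]
    exact scalarComp_whiskerRight _ _
  map₂_associator X Y Z := by
    refine scalarComp_associator _ _ _ _ _ ?_
    change χ.β (gammaInv (α_ (unmop Z) (unmop Y) (unmop X)).inv) =
      (χ.c (toSkeleton (unmop Z)) (toSkeleton (unmop Y ⊗ unmop X)))⁻¹ *
      (χ.c (toSkeleton (unmop Y)) (toSkeleton (unmop X)))⁻¹ *
      χ.c (toSkeleton (unmop Z)) (toSkeleton (unmop Y)) *
      χ.c (toSkeleton (unmop Z ⊗ unmop Y)) (toSkeleton (unmop X))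
    have h := gammaInv_comp (α_ (unmop Z) (unmop Y) (unmop X)).inv
      (α_ (unmop Z) (unmop Y) (unmop X)).hom
    rw [Iso.inv_hom_id, gammaInv_id] at h
    have h' := congrArg χ.β h
    rw [map_one, map_mul] at h'
    have h'' := χ.coboundary (unmop Z) (unmop Y) (unmop X)
    rw [assocCocycle, eq_inv_of_mul_eq_one_left h'.symm] at h''
    rw [Skeleton.toSkeleton_tensorObj, Skeleton.toSkeleton_tensorObj]
    exact coboundary_aux h''
  map₂_left_unitor X := by
    obtain ⟨e, he⟩ := IsSpecialTwoGroup.rightUnitor_eq (unmop X)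
    change scalarHom (χ.β (gammaInv (ρ_ (unmop X)).hom)) =
      (scalarComp (χ.c (toSkeleton (unmop X)) 1)).hom ≫ _
    rw [he, eqToIso.hom, gammaInv_eqToHom, χ.one_right, map_one, scalarHom_one]
    exact scalarComp_leftUnitor
  map₂_right_unitor X := by
    obtain ⟨e, he⟩ := IsSpecialTwoGroup.leftUnitor_eq (unmop X)
    change scalarHom (χ.β (gammaInv (λ_ (unmop X)).hom)) =
      (scalarComp (χ.c 1 (toSkeleton (unmop X)))).hom ≫ _
    rw [he, eqToIso.hom, gammaInv_eqToHom, χ.one_left, map_one, scalarHom_one]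
    exact scalarComp_rightUnitor

end special
end Reps

section Cohomology
universe u

/-- The group of 2-cocycles of a group with values in the trivial module `ℂˣ`. -/
def Z2 (G : Type u) [Group G] : Subgroup (G → G → ℂˣ) where
  carrier := {z | ∀ g h k, z h k * z g (h * k) = z (g * h) k * z g h}
  one_mem' _ _ _ := rfl
  mul_mem' {z w} hz hw g h k := by
    change z h k * w h k * (z g (h * k) * w g (h * k)) =
      z (g * h) k * w (g * h) k * (z g h * w g h)
    rw [mul_mul_mul_comm, hz, hw, mul_mul_mul_comm]
  inv_mem' {z} hz g h k := by
    change (z h k)⁻¹ * (z g (h * k))⁻¹ = (z (g * h) k)⁻¹ * (z g h)⁻¹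
    rw [← mul_inv, hz, mul_inv]

/-- The group of 2-coboundaries. -/
def B2 (G : Type u) [Group G] : Subgroup (G → G → ℂˣ) where
  carrier := {z | ∃ t : G → ℂˣ, ∀ g h, z g h = t h * (t (g * h))⁻¹ * t g}
  one_mem' := ⟨1, fun _ _ => by simp⟩
  mul_mem' := by
    rintro z w ⟨t, ht⟩ ⟨s, hs⟩
    refine ⟨t * s, fun g h => ?_⟩
    simp only [Pi.mul_apply, ht, hs, mul_inv]
    simp only [mul_comm, mul_left_comm, mul_assoc]
  inv_mem' := by
    rintro z ⟨t, ht⟩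
    refine ⟨t⁻¹, fun g h => ?_⟩
    simp only [Pi.inv_apply, ht, mul_inv]

/-- The second cohomology group `H²(G, ℂˣ)` of a group with values in the trivial module `ℂˣ`. -/
abbrev H2 (G : Type u) [Group G] : Type u := Z2 G ⧸ (B2 G).subgroupOf (Z2 G)

end Cohomology

section Reps
universe u

/-- The (finite dimensional, matrix) projective representations of `G` with 2-cocycle `z`. -/
structure PRep (G : Type u) [Group G] (z : G → G → ℂˣ) where
  dim : ℕ
  S : G → GL (Fin dim) ℂ
  mul : ∀ g h : G, (S g).val * (S h).val = (z g h : ℂ) • (S (g * h)).val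

/-- Intertwining matrices. -/
@[ext]
structure PRep.Hom {G : Type u} [Group G] {z : G → G → ℂˣ} (V W : PRep G z) where
  T : Matrix (Fin W.dim) (Fin V.dim) ℂ
  comm : ∀ g, T * (V.S g).val = (W.S g).val * T

instance {G : Type u} [Group G] {z : G → G → ℂˣ} : Category (PRep G z) where
  Hom := PRep.Hom
  id V := ⟨1, fun g => by rw [Matrix.one_mul, Matrix.mul_one]⟩
  comp f g := ⟨g.T * f.T, fun x => by
    rw [Matrix.mul_assoc, f.comm, ← Matrix.mul_assoc, g.comm, Matrix.mul_assoc]⟩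
  id_comp f := PRep.Hom.ext (Matrix.mul_one _)
  comp_id f := PRep.Hom.ext (Matrix.one_mul _)
  assoc f g h := PRep.Hom.ext (Matrix.mul_assoc _ _ _).symm

/-- The finite dimensional matrix representations of `G`. -/
structure MatRep (G : Type u) [Group G] where
  dim : ℕ
  S : G →* GL (Fin dim) ℂ

namespace MatRep
variable {G : Type u} [Group G]

/-- Intertwining matrices. -/
@[ext]
structure Hom (V W : MatRep G) where
  T : Matrix (Fin W.dim) (Fin V.dim) ℂ
  comm : ∀ g, T * (V.S g).val = (W.S g).val * T

instance : Category (MatRep G) where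
  Hom := Hom
  id V := ⟨1, fun g => by rw [Matrix.one_mul, Matrix.mul_one]⟩
  comp f g := ⟨g.T * f.T, fun x => by
    rw [Matrix.mul_assoc, f.comm, ← Matrix.mul_assoc, g.comm, Matrix.mul_assoc]⟩
  id_comp f := Hom.ext (Matrix.mul_one _)
  comp_id f := Hom.ext (Matrix.one_mul _)
  assoc f g h := Hom.ext (Matrix.mul_assoc _ _ _).symm

theorem hom_ext {V W : MatRep G} {f g : V ⟶ W} (h : f.T = g.T) : f = g := Hom.ext h

theorem comp_T {U V W : MatRep G} (f : U ⟶ V) (g : V ⟶ W) : (f ≫ g).T = g.T * f.T := rfl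

theorem id_T (V : MatRep G) : Hom.T (𝟙 V) = 1 := rfl

variable {a' b' c' a b c : ℕ}

/-- The Kronecker product of matrices, with rows and columns indexed lexicographically. -/
def kr (A : Matrix (Fin a') (Fin a) ℂ) (B : Matrix (Fin b') (Fin b) ℂ) :
    Matrix (Fin (a' * b')) (Fin (a * b)) ℂ :=
  Matrix.reindex finProdFinEquiv finProdFinEquiv (A ⊗ₖ B)

theorem kr_apply (A : Matrix (Fin a') (Fin a) ℂ) (B : Matrix (Fin b') (Fin b) ℂ) (i j k l) :
    kr A B (finProdFinEquiv (i, j)) (finProdFinEquiv (k, l)) = A i k * B j l := by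
  simp [kr]

theorem kr_ext {M N : Matrix (Fin (a' * b')) (Fin (a * b)) ℂ}
    (h : ∀ i j k l, M (finProdFinEquiv (i, j)) (finProdFinEquiv (k, l)) =
      N (finProdFinEquiv (i, j)) (finProdFinEquiv (k, l))) : M = N := by
  ext x y
  obtain ⟨⟨i, j⟩, rfl⟩ := finProdFinEquiv.surjective x
  obtain ⟨⟨k, l⟩, rfl⟩ := finProdFinEquiv.surjective y
  exact h i j k l

theorem kr_mul {a'' b'' : ℕ} (A : Matrix (Fin a') (Fin a) ℂ) (B : Matrix (Fin b') (Fin b) ℂ)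
    (A' : Matrix (Fin a'') (Fin a') ℂ) (B' : Matrix (Fin b'') (Fin b') ℂ) :
    kr A' B' * kr A B = kr (A' * A) (B' * B) := by
  rw [kr, kr, kr, Matrix.mul_kronecker_mul]
  simp

theorem kr_one : kr (1 : Matrix (Fin a) (Fin a) ℂ) (1 : Matrix (Fin b) (Fin b) ℂ) = 1 := by
  rw [kr, Matrix.one_kronecker_one]
  simp

/-- The tensor product of invertible matrices. -/
def krGL (A : GL (Fin a) ℂ) (B : GL (Fin b) ℂ) : GL (Fin (a * b)) ℂ where
  val := kr A.val B.val
  inv := kr (A⁻¹).val (B⁻¹).val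
  val_inv := by rw [kr_mul, Units.mul_inv, Units.mul_inv, kr_one]
  inv_val := by rw [kr_mul, Units.inv_mul, Units.inv_mul, kr_one]

/-- The tensor product of representations. -/
def tensor (V W : MatRep G) : MatRep G where
  dim := V.dim * W.dim
  S := { toFun := fun g => krGL (V.S g) (W.S g)
         map_one' := Units.ext (by rw [map_one, map_one]; exact kr_one)
         map_mul' := fun g h => Units.ext (by
          rw [Units.val_mul]
          refine Eq.trans ?_ (kr_mul _ _ _ _).symm
          rw [← Units.val_mul, ← Units.val_mul, ← map_mul, ← map_mul]
          rfl) }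

/-- The trivial representation of dimension 1. -/
def triv : MatRep G where
  dim := 1
  S := 1

/-- The tensor product of intertwiners. -/
def tensorMap {V V' W W' : MatRep G} (f : V ⟶ V') (g : W ⟶ W') : tensor V W ⟶ tensor V' W' where
  T := kr f.T g.T
  comm x := by
    refine (kr_mul _ _ _ _).trans (Eq.trans ?_ (kr_mul _ _ _ _).symm)
    rw [f.comm, g.comm]

theorem permMat_mul_eq (σ : Fin a ≃ Fin b) (τ : Fin a' ≃ Fin b') {M : Matrix (Fin a') (Fin a) ℂ}
    {N : Matrix (Fin b') (Fin b) ℂ} (h : ∀ x y, M x y = N (τ x) (σ y)) :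
    permMat τ * M = N * permMat σ := by
  rw [permMat_mul, mul_permMat]
  ext x y
  simp [h]

/-- An isomorphism of representations given by a bijection between the index sets. -/
def permIso {V W : MatRep G} (σ : Fin V.dim ≃ Fin W.dim)
    (h : ∀ g x y, (V.S g).val x y = (W.S g).val (σ x) (σ y)) : V ≅ W where
  hom := ⟨permMat σ, fun g => permMat_mul_eq σ σ (h g)⟩
  inv := ⟨permMat σ.symm, fun g => permMat_mul_eq σ.symm σ.symm fun x y => by rw [h]; simp⟩
  hom_inv_id := hom_ext (by rw [comp_T, permMat_mul_permMat]; simp [permMat_refl, id_T])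
  inv_hom_id := hom_ext (by rw [comp_T, permMat_mul_permMat]; simp [permMat_refl, id_T])

variable (a b c) in
/-- The associativity bijection. -/
def assocE : Fin (a * b * c) ≃ Fin (a * (b * c)) :=
  finProdFinEquiv.symm.trans <| (finProdFinEquiv.symm.prodCongr (Equiv.refl _)).trans <|
    (Equiv.prodAssoc _ _ _).trans <| ((Equiv.refl _).prodCongr finProdFinEquiv).trans
      finProdFinEquiv

variable (a) in
/-- The left unit bijection. -/
def lunitE : Fin (1 * a) ≃ Fin a := finProdFinEquiv.symm.trans (Equiv.uniqueProd _ _)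

variable (a) in
/-- The right unit bijection. -/
def runitE : Fin (a * 1) ≃ Fin a := finProdFinEquiv.symm.trans (Equiv.prodUnique _ _)

theorem assocE_apply (i : Fin a) (j : Fin b) (k : Fin c) :
    assocE a b c (finProdFinEquiv (finProdFinEquiv (i, j), k)) =
      finProdFinEquiv (i, finProdFinEquiv (j, k)) := by
  simp [assocE]

theorem lunitE_apply (i : Fin 1) (j : Fin a) : lunitE a (finProdFinEquiv (i, j)) = j := by
  simp [lunitE]

theorem runitE_apply (i : Fin 1) (j : Fin a) : runitE a (finProdFinEquiv (j, i)) = j := by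
  simp [runitE]

theorem kr_assoc (A : Matrix (Fin a') (Fin a) ℂ) (B : Matrix (Fin b') (Fin b) ℂ)
    (C : Matrix (Fin c') (Fin c) ℂ) (x y) :
    kr (kr A B) C x y = kr A (kr B C) (assocE _ _ _ x) (assocE _ _ _ y) := by
  obtain ⟨⟨x, x₃⟩, rfl⟩ := finProdFinEquiv.surjective x
  obtain ⟨⟨x₁, x₂⟩, rfl⟩ := finProdFinEquiv.surjective x
  obtain ⟨⟨y, y₃⟩, rfl⟩ := finProdFinEquiv.surjective y
  obtain ⟨⟨y₁, y₂⟩, rfl⟩ := finProdFinEquiv.surjective y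
  rw [assocE_apply, assocE_apply, kr_apply, kr_apply, kr_apply, kr_apply, mul_assoc]

theorem kr_lunit (A : Matrix (Fin a') (Fin a) ℂ) (x y) :
    kr (1 : Matrix (Fin 1) (Fin 1) ℂ) A x y = A (lunitE _ x) (lunitE _ y) := by
  obtain ⟨⟨x₁, x₂⟩, rfl⟩ := finProdFinEquiv.surjective x
  obtain ⟨⟨y₁, y₂⟩, rfl⟩ := finProdFinEquiv.surjective y
  rw [lunitE_apply, lunitE_apply, kr_apply, Subsingleton.elim x₁ y₁, Matrix.one_apply_eq, one_mul]

theorem kr_runit (A : Matrix (Fin a') (Fin a) ℂ) (x y) :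
    kr A (1 : Matrix (Fin 1) (Fin 1) ℂ) x y = A (runitE _ x) (runitE _ y) := by
  obtain ⟨⟨x₁, x₂⟩, rfl⟩ := finProdFinEquiv.surjective x
  obtain ⟨⟨y₁, y₂⟩, rfl⟩ := finProdFinEquiv.surjective y
  rw [runitE_apply, runitE_apply, kr_apply, Subsingleton.elim x₂ y₂, Matrix.one_apply_eq, mul_one]

theorem reindex_permMat {X X' Y Y' : Type} [DecidableEq X'] [DecidableEq Y'] (e : X ≃ Y)
    (e' : X' ≃ Y') (τ : X ≃ X') :
    Matrix.reindex e' e (permMat τ) = permMat (e.symm.trans (τ.trans e')) := by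
  ext x y
  simp only [permMat, Matrix.reindex_apply, Matrix.submatrix_apply, Matrix.one_apply, id,
    Equiv.symm_apply_eq]
  rfl

theorem kr_permMat_one (σ : Fin a ≃ Fin a') :
    kr (permMat σ) (1 : Matrix (Fin b) (Fin b) ℂ) =
      permMat (finProdFinEquiv.symm.trans
        ((σ.prodCongr (Equiv.refl _)).trans finProdFinEquiv)) := by
  rw [kr, permMat_kronecker_one, reindex_permMat]

theorem kr_one_permMat (σ : Fin a ≃ Fin a') :
    kr (1 : Matrix (Fin b) (Fin b) ℂ) (permMat σ) =
      permMat (finProdFinEquiv.symm.trans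
        (((Equiv.refl _).prodCongr σ).trans finProdFinEquiv)) := by
  rw [kr, permMat_one_kronecker, reindex_permMat]

theorem kr_pentagon (a b c d : ℕ) :
    kr (1 : Matrix (Fin a) (Fin a) ℂ) (permMat (assocE b c d)) * permMat (assocE a (b * c) d) *
      kr (permMat (assocE a b c)) (1 : Matrix (Fin d) (Fin d) ℂ) =
    permMat (assocE a b (c * d)) * permMat (assocE (a * b) c d) := by
  rw [kr_permMat_one, kr_one_permMat, permMat_mul_permMat, permMat_mul_permMat,
    permMat_mul_permMat]
  congr 1
  refine Equiv.ext fun x => ?_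
  obtain ⟨⟨x, x₄⟩, rfl⟩ := finProdFinEquiv.surjective x
  obtain ⟨⟨x, x₃⟩, rfl⟩ := finProdFinEquiv.surjective x
  obtain ⟨⟨x₁, x₂⟩, rfl⟩ := finProdFinEquiv.surjective x
  simp only [Equiv.trans_apply, Equiv.symm_apply_apply, Equiv.prodCongr_apply, Prod.map,
    assocE_apply, Equiv.refl_apply]

theorem kr_triangle (a b : ℕ) :
    kr (1 : Matrix (Fin a) (Fin a) ℂ) (permMat (lunitE b)) * permMat (assocE a 1 b) =
      kr (permMat (runitE a)) (1 : Matrix (Fin b) (Fin b) ℂ) := by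
  rw [kr_permMat_one, kr_one_permMat, permMat_mul_permMat]
  congr 1
  refine Equiv.ext fun x => ?_
  obtain ⟨⟨x, x₃⟩, rfl⟩ := finProdFinEquiv.surjective x
  obtain ⟨⟨x₁, x₂⟩, rfl⟩ := finProdFinEquiv.surjective x
  simp only [Equiv.trans_apply, Equiv.symm_apply_apply, Equiv.prodCongr_apply, Prod.map,
    assocE_apply, Equiv.refl_apply, lunitE_apply, runitE_apply]

/-- Matrix representations form a monoidal category with the usual tensor product. -/
instance : MonoidalCategory (MatRep G) where
  tensorObj := tensor
  tensorHom := tensorMap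
  whiskerLeft V _ _ f := tensorMap (𝟙 V) f
  whiskerRight f V := tensorMap f (𝟙 V)
  tensorUnit := triv
  associator U V W := permIso (V := tensor (tensor U V) W) (W := tensor U (tensor V W))
    (assocE U.dim V.dim W.dim) fun _ => kr_assoc _ _ _
  leftUnitor V := permIso (V := tensor triv V) (lunitE V.dim) fun _ => kr_lunit _
  rightUnitor V := permIso (V := tensor V triv) (runitE V.dim) fun _ => kr_runit _
  tensorHom_def f g := hom_ext (by
    refine Eq.trans ?_ (kr_mul _ _ _ _).symm
    exact congrArg₂ kr (Matrix.one_mul _).symm (Matrix.mul_one _).symm)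
  id_tensorHom_id V W := hom_ext kr_one
  tensorHom_comp_tensorHom f g h k := hom_ext (kr_mul _ _ _ _)
  whiskerLeft_id V W := hom_ext kr_one
  id_whiskerRight V W := hom_ext kr_one
  associator_naturality f g h := hom_ext (permMat_mul_eq _ _ (kr_assoc f.T g.T h.T))
  leftUnitor_naturality f := hom_ext (permMat_mul_eq _ _ (kr_lunit f.T))
  rightUnitor_naturality f := hom_ext (permMat_mul_eq _ _ (kr_runit f.T))
  pentagon U V W X := hom_ext (by
    rw [comp_T, comp_T, comp_T]
    exact kr_pentagon U.dim V.dim W.dim X.dim)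
  triangle U V := hom_ext (kr_triangle U.dim V.dim)

end MatRep
end Reps

section Main
open MonoidalCategory
universe v₁ u₁ v₂ u₂
variable {G : Type u₁} [Category.{v₁} G] [MonoidalCategory G]
  {S : Type u₂} [Category.{v₂} S] [MonoidalCategory S] [IsSpecialTwoGroup S]

/-- The representation `I_{β,c}` of a 2-group `G` equivalent to a special 2-group `S`: the
representation of `S` restricted along the equivalence `E : G ⥤ S`. -/
def charRep (E : G ⥤ S) [E.Monoidal] (χ : CharacterData S) : Pseudofunctor (Deloop G) TwoMat :=
  (deloopMap E).comp χ.rep₀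

/-- The 2-cochain `c' - c` (written multiplicatively), as a cochain on `π₀(G)`. -/
def diffCochain (E : G ⥤ S) [E.Monoidal] (χ χ' : CharacterData S) (g h : Pi0 G) : ℂˣ :=
  χ'.c (Skeleton.monoidHom E g) (Skeleton.monoidHom E h) *
    (χ.c (Skeleton.monoidHom E g) (Skeleton.monoidHom E h))⁻¹

end Main
end TwoRep

end

open CategoryTheory TwoRep
open scoped Pseudofunctor.StrongTrans

universe v₁ u₁ v₂ u₂

/-!
A transformation `θ` between two representations `charRep E χ` and `charRep E χ'` consists of an
endomorphism `r` of the object `1` of `TwoMat` and of invertible 2-morphisms `𝟙 ≫ r ≅ r ≫ 𝟙`, one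
for each object `X` of the 2-group. Removing the units (`straighten`) turns these into automorphisms
of `r`, which are determined by their only entry: a matrix `M X` in `GL d` (`transMat`), where `d`
is the rank of `r`. Both representations act by scalars, and whiskering with `r` is linear, so the
axioms of a transformation become equations of matrices involving only scalars, in which the gauge
of `r` plays no role:

* for a morphism `f : X ⟶ Y`, the matrices `β(f) • M Y` and `β'(f) • M X` agree
  (`transMat_natural`);
* `M (Y ⊗ X)` is a multiple of `M X * M Y`, with the scalar determined by the constraints of the
  two representations (`transMat_tensor`), and there is a similar equation for the unit.

A modification is a matrix which intertwines the `M X` (`modMat_comm`), and conversely any matrices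
with these properties come from transformations and modifications (`mkTrans`, `mkMod`).

If `β ≠ β'`, some automorphism of the unit object has different values under `β` and `β'`. Then
the first equation says that a nonzero multiple of an invertible matrix is zero, so all
transformations have rank `0`, all spaces of modifications are zero, and the zero transformation
exists (`hom_equiv_terminal`).

If `β = β'`, the first equation says that `M` only depends on the class of `X` in `π₀`. In the
second one the contributions of the coherence isomorphisms of `E` to the two constraints cancel.
Hence `(M X)⁻¹` is a projective representation with cocycle `c' / c`, which is a cocycle because
`∂c = β ∘ α = ∂c'`. This gives an equivalence of categories (`toPRep`). Projective
representations with cohomologous cocycles are related by rescaling (`rescale`).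

For `χ = χ'` one gets linear representations (`toMatRep`). The composite of endomorphisms of ranks
`d` and `e` has rank `e * d`; the gauge enters in the identification of its index set with that of
a Kronecker product (`kron`). The definition of whiskering, of the associator and of the unitors in
`TwoMat` says precisely that this identification is natural, associative and unital, which makes
`toMatRep` monoidal (`toMatRepMonoidal`).
-/

namespace TwoRep

/-! ### Removing units from the constraints of a transformation -/

section Straighten
open Bicategory
universe w v u
variable {C : Type u} [Bicategory.{w, v} C] {X : C}

/-- The automorphism of `r` obtained from a naturality constraint `𝟙 ≫ r ≅ r ≫ 𝟙` by removing
the units. -/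
abbrev straightenIso {r : X ⟶ X} (n : 𝟙 X ≫ r ≅ r ≫ 𝟙 X) : r ≅ r :=
  (λ_ r).symm ≪≫ n ≪≫ ρ_ r

/-- The 2-morphism version of `straightenIso`. -/
def straighten {r : X ⟶ X} (n : 𝟙 X ≫ r ⟶ r ≫ 𝟙 X) : r ⟶ r :=
  (λ_ r).inv ≫ n ≫ (ρ_ r).hom

/-- The action of endomorphisms of the unit on a 1-morphism, from the side of its source. -/
def lact (x : 𝟙 X ⟶ 𝟙 X) (r : X ⟶ X) : r ⟶ r := (λ_ r).inv ≫ x ▷ r ≫ (λ_ r).hom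

/-- The action of endomorphisms of the unit on a 1-morphism, from the side of its target. -/
def ract (r : X ⟶ X) (x : 𝟙 X ⟶ 𝟙 X) : r ⟶ r := (ρ_ r).inv ≫ r ◁ x ≫ (ρ_ r).hom

/-- The naturality axiom of a transformation, straightened. -/
theorem straighten_natural_iff {r : X ⟶ X} (n n' : 𝟙 X ≫ r ⟶ r ≫ 𝟙 X) (x y : 𝟙 X ⟶ 𝟙 X) :
    x ▷ r ≫ n' = n ≫ r ◁ y ↔ lact x r ≫ straighten n' = straighten n ≫ ract r y := by
  rw [← cancel_mono (ρ_ r).hom, ← cancel_epi (λ_ r).inv]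
  simp only [straighten, lact, ract, Category.assoc, Iso.hom_inv_id_assoc]

/-- The unit axiom of a transformation, straightened. -/
theorem straighten_id_iff {r : X ⟶ X} (n : 𝟙 X ≫ r ⟶ r ≫ 𝟙 X) (x y : 𝟙 X ⟶ 𝟙 X) :
    n ≫ r ◁ y = x ▷ r ≫ (λ_ r).hom ≫ (ρ_ r).inv ↔ straighten n ≫ ract r y = lact x r := by
  rw [← cancel_mono (ρ_ r).hom, ← cancel_epi (λ_ r).inv]
  simp only [straighten, lact, ract, Category.assoc, Iso.hom_inv_id_assoc, Iso.inv_hom_id,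
    Category.comp_id]

/-- The composition axiom of a transformation, straightened. -/
theorem straighten_comp_iff {r : X ⟶ X} (l m n : 𝟙 X ≫ r ⟶ r ≫ 𝟙 X) (x y : 𝟙 X ⟶ 𝟙 X) :
    l ≫ r ◁ (y ≫ (λ_ (𝟙 X)).inv) = (x ≫ (λ_ (𝟙 X)).inv) ▷ r ≫ (α_ _ _ _).hom ≫ 𝟙 X ◁ m ≫
      (α_ _ _ _).inv ≫ n ▷ 𝟙 X ≫ (α_ _ _ _).hom ↔
    straighten l ≫ ract r y = lact x r ≫ straighten m ≫ straighten n := by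
  rw [← cancel_mono (r ◁ (λ_ (𝟙 X)).hom ≫ (ρ_ r).hom), ← cancel_epi (λ_ r).inv]
  have : (α_ _ _ _).hom ≫ 𝟙 X ◁ m ≫
      (α_ _ _ _).inv ≫ n ▷ 𝟙 X ≫ (α_ _ _ _).hom ≫ r ◁ (λ_ (𝟙 X)).hom ≫ (ρ_ r).hom =
      (λ_ (𝟙 X)).hom ▷ r ≫ (λ_ r).hom ≫ straighten m ≫ straighten n := by
    rw [straighten, straighten]; bicategory
  simp only [comp_whiskerRight, Category.assoc, this]
  simp [straighten, lact, ract]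

/-- The axiom of a modification, straightened. -/
theorem straighten_modification_iff {r r' : X ⟶ X} (n : 𝟙 X ≫ r ⟶ r ≫ 𝟙 X)
    (n' : 𝟙 X ≫ r' ⟶ r' ≫ 𝟙 X) (T : r ⟶ r') :
    𝟙 X ◁ T ≫ n' = n ≫ T ▷ 𝟙 X ↔ T ≫ straighten n' = straighten n ≫ T := by
  rw [← cancel_mono (ρ_ r').hom, ← cancel_epi (λ_ r).inv]
  simp [straighten]

/-- The naturality constraint of a vertical composite of transformations, straightened. -/
theorem straighten_vcomp {r t : X ⟶ X} (n : 𝟙 X ≫ r ⟶ r ≫ 𝟙 X) (m : 𝟙 X ≫ t ⟶ t ≫ 𝟙 X) :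
    straighten ((α_ _ _ _).inv ≫ n ▷ t ≫ (α_ _ _ _).hom ≫ r ◁ m ≫ (α_ _ _ _).inv) =
      straighten n ▷ t ≫ r ◁ straighten m := by
  rw [straighten, straighten, straighten]; bicategory

end Straighten

/-! ### The matrix of a 2-morphism between endomorphisms of the object `1` -/

section Entries

local notation "pt" => TwoMat.mk 1

variable {r s t : pt ⟶ pt}

/-- The matrix of a 2-morphism between endomorphisms of the object `1`, that is, its only
entry. -/
def entry (f : r ⟶ s) : Matrix (Fin (s.R 0 0)) (Fin (r.R 0 0)) ℂ := f 0 0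

/-- The 2-morphism with a given matrix. -/
def homOfEntry (A : Matrix (Fin (s.R 0 0)) (Fin (r.R 0 0)) ℂ) : r ⟶ s
  | ⟨0, _⟩, ⟨0, _⟩ => A

theorem entry_injective {f g : r ⟶ s} (h : entry f = entry g) : f = g := by
  funext i j
  obtain rfl := Subsingleton.elim 0 i
  obtain rfl := Subsingleton.elim 0 j
  exact h

theorem entry_inj {f g : r ⟶ s} : entry f = entry g ↔ f = g :=
  ⟨entry_injective, congrArg entry⟩

theorem entry_comp (f : r ⟶ s) (g : s ⟶ t) : entry (f ≫ g) = entry g * entry f := rfl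

theorem entry_id : entry (𝟙 r) = 1 := rfl

/-- The invertible matrix of an invertible 2-morphism. -/
def entryGL (i : r ≅ r) : GL (Fin (r.R 0 0)) ℂ where
  val := entry i.hom
  inv := entry i.inv
  val_inv := by rw [← entry_comp, i.inv_hom_id, entry_id]
  inv_val := by rw [← entry_comp, i.hom_inv_id, entry_id]

/-- The invertible 2-morphism with a given invertible matrix. -/
def isoOfGL (A : GL (Fin (r.R 0 0)) ℂ) : r ≅ r where
  hom := homOfEntry A.val
  inv := homOfEntry (A⁻¹).val
  hom_inv_id := entry_injective A.inv_mul
  inv_hom_id := entry_injective A.mul_inv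

/-- Scalars can be pulled out of a whiskering, whatever the gauge is, since whiskering is linear. -/
theorem entry_scalarHom_whiskerRight (z : ℂˣ) (r : pt ⟶ pt) :
    entry (Bicategory.whiskerRight (scalarHom z) r) = (z : ℂ) • 1 := by
  have h : entry _ = entry _ := congrArg entry (Bicategory.id_whiskerRight (𝟙 pt) r)
  rw [entry_id, entry, whiskerRight_entry] at h
  rw [← h, entry, whiskerRight_entry]
  have : (Matrix.blockDiagonal' fun k =>
      (1 : Matrix (Fin (r.R 0 k)) (Fin (r.R 0 k)) ℂ) ⊗ₖ (scalarHom z k 0)) =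
      (z : ℂ) • (Matrix.blockDiagonal' fun k =>
        (1 : Matrix (Fin (r.R 0 k)) (Fin (r.R 0 k)) ℂ) ⊗ₖ ((𝟙 (𝟙 pt) : 𝟙 pt ⟶ 𝟙 pt) k 0)) := by
    rw [← Matrix.blockDiagonal'_smul]
    congr 1
    funext k
    exact Matrix.kronecker_smul _ _ _
  rw [this, Matrix.mul_smul, Matrix.smul_mul]
  rfl

theorem entry_whiskerLeft_scalarHom (z : ℂˣ) (r : pt ⟶ pt) :
    entry (Bicategory.whiskerLeft r (scalarHom z)) = (z : ℂ) • 1 := by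
  have h : entry _ = entry _ := congrArg entry (Bicategory.whiskerLeft_id r (𝟙 pt))
  rw [entry_id, entry, whiskerLeft_entry] at h
  rw [← h, entry, whiskerLeft_entry]
  have : (Matrix.blockDiagonal' fun k =>
      (scalarHom z 0 k) ⊗ₖ (1 : Matrix (Fin (r.R k 0)) (Fin (r.R k 0)) ℂ)) =
      (z : ℂ) • (Matrix.blockDiagonal' fun k =>
        ((𝟙 (𝟙 pt) : 𝟙 pt ⟶ 𝟙 pt) 0 k) ⊗ₖ (1 : Matrix (Fin (r.R k 0)) (Fin (r.R k 0)) ℂ)) := by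
    rw [← Matrix.blockDiagonal'_smul]
    congr 1
    funext k
    exact Matrix.smul_kronecker _ _ _
  rw [this, Matrix.mul_smul, Matrix.smul_mul]
  rfl

theorem entry_lact (z : ℂˣ) (r : pt ⟶ pt) : entry (lact (scalarHom z) r) = (z : ℂ) • 1 := by
  rw [lact, entry_comp, entry_comp, entry_scalarHom_whiskerRight, Matrix.mul_smul,
    Matrix.smul_mul, Matrix.mul_one, ← entry_comp, Iso.inv_hom_id, entry_id]

theorem entry_ract (z : ℂˣ) (r : pt ⟶ pt) : entry (ract r (scalarHom z)) = (z : ℂ) • 1 := by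
  rw [ract, entry_comp, entry_comp, entry_whiskerLeft_scalarHom, Matrix.mul_smul,
    Matrix.smul_mul, Matrix.mul_one, ← entry_comp, Iso.inv_hom_id, entry_id]

end Entries

/-! ### Transformations and modifications as matrices -/

section Transformations
open MonoidalCategory MonoidalOpposite

local notation "pt" => TwoMat.mk 1

variable {G : Type u₁} [Category.{v₁} G] [MonoidalCategory G]
  {S : Type u₂} [Category.{v₂} S] [MonoidalCategory S] [IsSpecialTwoGroup S]
  (E : G ⥤ S) [E.Monoidal]

local notation "st" => MonoidalSingleObj.star Gᴹᵒᵖ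

/-- The scalar by which a morphism of `G` acts in `charRep E χ`. -/
noncomputable def homScalar (χ : CharacterData S) {X Y : G} (f : X ⟶ Y) : ℂˣ :=
  χ.β (gammaInv (E.map f))

/-- The scalar of the composition constraint of `charRep E χ` at the 1-morphisms `X`, `Y` of the
delooping of `G`, whose composite is `Y ⊗ X`. -/
noncomputable def compScalar (χ : CharacterData S) (X Y : G) : ℂˣ :=
  (χ.c (toSkeleton (E.obj Y)) (toSkeleton (E.obj X)))⁻¹ *
    χ.β (gammaInv (Functor.OplaxMonoidal.δ E Y X))

/-- The scalar of the unit constraint of `charRep E χ`. -/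
noncomputable def unitScalar (χ : CharacterData S) : ℂˣ :=
  χ.β (gammaInv (Functor.OplaxMonoidal.η E))

theorem charRep_mapComp_hom (χ : CharacterData S) (X Y : st ⟶ st) :
    ((charRep E χ).mapComp X Y).hom =
      (scalarHom (compScalar E χ (unmop X) (unmop Y)) ≫ (Bicategory.leftUnitor _).inv :
        𝟙 pt ⟶ 𝟙 pt ≫ 𝟙 pt) := by
  rw [compScalar, scalarHom_mul, Category.assoc, ← scalarComp_hom]
  rfl

theorem charRep_mapId_hom (χ : CharacterData S) :
    ((charRep E χ).mapId st).hom = (scalarHom (unitScalar E χ) : 𝟙 pt ⟶ 𝟙 pt) :=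
  Category.comp_id _

variable {E} {χ χ' : CharacterData S}

/-- The underlying 1-morphism of a transformation. -/
abbrev base (θ : charRep E χ ⟶ charRep E χ') : pt ⟶ pt := θ.app st

/-- The naturality constraint of a transformation at an object `X`. -/
abbrev constraint (θ : charRep E χ ⟶ charRep E χ') (X : G) :
    𝟙 pt ≫ base θ ≅ base θ ≫ 𝟙 pt :=
  θ.naturality (a := st) (b := st) (mop X)

/-- The matrices of the straightened naturality constraints of a transformation. -/
noncomputable def transMat (θ : charRep E χ ⟶ charRep E χ') (X : G) : GL (Fin ((base θ).R 0 0)) ℂ :=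
  entryGL (straightenIso (constraint θ X))

/-- The naturality axiom of a transformation between representations on the object `1`, as an
equation of matrices. -/
theorem natural_iff {r : pt ⟶ pt} (n n' : 𝟙 pt ≫ r ⟶ r ≫ 𝟙 pt) (x y : ℂˣ) :
    Bicategory.whiskerRight (scalarHom x) r ≫ n' =
        n ≫ Bicategory.whiskerLeft r (scalarHom y) ↔
      (x : ℂ) • entry (straighten n') = (y : ℂ) • entry (straighten n) := by
  rw [straighten_natural_iff, ← entry_inj]
  simp only [entry_comp, entry_lact, entry_ract, Matrix.mul_smul, Matrix.mul_one,
    Matrix.smul_mul, Matrix.one_mul]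

/-- The unit axiom of a transformation, as an equation of matrices. -/
theorem unit_iff {r : pt ⟶ pt} (n : 𝟙 pt ≫ r ⟶ r ≫ 𝟙 pt) (x y : ℂˣ) :
    n ≫ Bicategory.whiskerLeft r (scalarHom y) = Bicategory.whiskerRight (scalarHom x) r ≫
        (Bicategory.leftUnitor r).hom ≫ (Bicategory.rightUnitor r).inv ↔
      (y : ℂ) • entry (straighten n) = (x : ℂ) • 1 := by
  rw [straighten_id_iff, ← entry_inj]
  simp only [entry_comp, entry_lact, entry_ract, Matrix.smul_mul, Matrix.one_mul]

/-- The composition axiom of a transformation, as an equation of matrices. The order of the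
factors is reversed: `l` is the constraint at a composite `X ≫ Y`, and `m`, `n` are those at `Y` and
`X`. -/
theorem comp_iff {r : pt ⟶ pt} (l m n : 𝟙 pt ≫ r ⟶ r ≫ 𝟙 pt) (x y : ℂˣ) :
    l ≫ Bicategory.whiskerLeft r (scalarHom y ≫ (Bicategory.leftUnitor (𝟙 pt)).inv) =
        Bicategory.whiskerRight (scalarHom x ≫ (Bicategory.leftUnitor (𝟙 pt)).inv) r ≫
        (Bicategory.associator _ _ _).hom ≫ Bicategory.whiskerLeft (𝟙 pt) m ≫
        (Bicategory.associator _ _ _).inv ≫ Bicategory.whiskerRight n (𝟙 pt) ≫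
        (Bicategory.associator _ _ _).hom ↔
      (y : ℂ) • entry (straighten l) =
        (x : ℂ) • (entry (straighten n) * entry (straighten m)) := by
  rw [straighten_comp_iff, ← entry_inj]
  simp only [entry_comp, entry_lact, entry_ract, Matrix.mul_smul, Matrix.mul_one,
    Matrix.smul_mul, Matrix.one_mul]

theorem transMat_natural (θ : charRep E χ ⟶ charRep E χ') {X Y : G} (f : X ⟶ Y) :
    (homScalar E χ f : ℂ) • (transMat θ Y).val = (homScalar E χ' f : ℂ) • (transMat θ X).val :=
  (natural_iff (constraint θ X).hom (constraint θ Y).hom _ _).1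
    (θ.naturality_naturality (a := st) (b := st) f.mop)

/-- The matrices of a transformation reverse products, since `Y ⊗ X` is the composite `X ≫ Y` in
the delooping. -/
theorem transMat_tensor (θ : charRep E χ ⟶ charRep E χ') (X Y : G) :
    (compScalar E χ' X Y : ℂ) • (transMat θ (Y ⊗ X)).val =
      (compScalar E χ X Y : ℂ) • ((transMat θ X).val * (transMat θ Y).val) := by
  have h := θ.naturality_comp (a := st) (b := st) (c := st) (mop X) (mop Y)
  rw [charRep_mapComp_hom, charRep_mapComp_hom] at h
  exact (comp_iff (constraint θ (Y ⊗ X)).hom (constraint θ Y).hom (constraint θ X).hom _ _).1 h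

/-- The constraint with a given straightened matrix. -/
noncomputable def constraintOfGL {r : pt ⟶ pt} (A : GL (Fin (r.R 0 0)) ℂ) : 𝟙 pt ≫ r ≅ r ≫ 𝟙 pt :=
  (Bicategory.leftUnitor r) ≪≫ isoOfGL A ≪≫ (Bicategory.rightUnitor r).symm

theorem entry_straighten_constraintOfGL {r : pt ⟶ pt} (A : GL (Fin (r.R 0 0)) ℂ) :
    entry (straighten (constraintOfGL A).hom) = A.val := by
  simp only [straighten, constraintOfGL, Iso.trans_hom, Iso.symm_hom, Category.assoc,
    Iso.inv_hom_id, Iso.inv_hom_id_assoc, Category.comp_id]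
  rfl

/-- The transformation with given straightened constraints. -/
noncomputable def mkTrans (r : pt ⟶ pt) (M : G → GL (Fin (r.R 0 0)) ℂ)
    (natural : ∀ {X Y : G} (f : X ⟶ Y),
      (homScalar E χ f : ℂ) • (M Y).val = (homScalar E χ' f : ℂ) • (M X).val)
    (unit : (unitScalar E χ' : ℂ) • (M (𝟙_ G)).val = (unitScalar E χ : ℂ) • 1)
    (tensor : ∀ X Y : G, (compScalar E χ' X Y : ℂ) • (M (Y ⊗ X)).val =
      (compScalar E χ X Y : ℂ) • ((M X).val * (M Y).val)) :
    charRep E χ ⟶ charRep E χ' where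
  app _ := r
  naturality X := constraintOfGL (M (unmop X))
  naturality_naturality {_ _ X Y} f := by
    refine (natural_iff (constraintOfGL (M (unmop X))).hom (constraintOfGL (M (unmop Y))).hom
      _ _).2 ?_
    rw [entry_straighten_constraintOfGL, entry_straighten_constraintOfGL]
    exact natural (Quiver.Hom.unmop f)
  naturality_id a := by
    cases a
    have h := (unit_iff (constraintOfGL (M (𝟙_ G))).hom (unitScalar E χ) (unitScalar E χ')).2
      (by rw [entry_straighten_constraintOfGL]; exact unit)
    rw [← charRep_mapId_hom, ← charRep_mapId_hom] at h
    exact h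
  naturality_comp {a b c} X Y := by
    cases a; cases b; cases c
    have h := (comp_iff (constraintOfGL (M (unmop Y ⊗ unmop X))).hom
      (constraintOfGL (M (unmop Y))).hom (constraintOfGL (M (unmop X))).hom
      (compScalar E χ (unmop X) (unmop Y)) (compScalar E χ' (unmop X) (unmop Y))).2 (by
        rw [entry_straighten_constraintOfGL, entry_straighten_constraintOfGL,
          entry_straighten_constraintOfGL]
        exact tensor _ _)
    rw [← charRep_mapComp_hom, ← charRep_mapComp_hom] at h
    exact h

theorem transMat_mkTrans (r : pt ⟶ pt) (M : G → GL (Fin (r.R 0 0)) ℂ) (h₁ h₂ h₃) (X : G) :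
    transMat (mkTrans (χ := χ) (χ' := χ') (E := E) r M h₁ h₂ h₃) X = M X :=
  Units.ext (entry_straighten_constraintOfGL (M X))

/-- The matrix of a modification. -/
noncomputable def modMat {θ θ' : charRep E χ ⟶ charRep E χ'} (Γ : θ ⟶ θ') :
    Matrix (Fin ((base θ').R 0 0)) (Fin ((base θ).R 0 0)) ℂ :=
  entry (r := base θ) (s := base θ') (Γ.as.app st)

/-- The axiom of a modification, as an equation of matrices. -/
theorem modification_iff {r r' : pt ⟶ pt} (n : 𝟙 pt ≫ r ⟶ r ≫ 𝟙 pt)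
    (n' : 𝟙 pt ≫ r' ⟶ r' ≫ 𝟙 pt) (T : r ⟶ r') :
    Bicategory.whiskerLeft (𝟙 pt) T ≫ n' = n ≫ Bicategory.whiskerRight T (𝟙 pt) ↔
      entry (straighten n') * entry T = entry T * entry (straighten n) := by
  rw [straighten_modification_iff, ← entry_inj, entry_comp, entry_comp]

theorem modMat_comm {θ θ' : charRep E χ ⟶ charRep E χ'} (Γ : θ ⟶ θ') (X : G) :
    (transMat θ' X).val * modMat Γ = modMat Γ * (transMat θ X).val :=
  (modification_iff (constraint θ X).hom (constraint θ' X).hom _).1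
    (Γ.as.naturality (a := st) (b := st) (mop X))

theorem modMat_injective {θ θ' : charRep E χ ⟶ charRep E χ'} {Γ Δ : θ ⟶ θ'}
    (h : modMat Γ = modMat Δ) : Γ = Δ := by
  refine Pseudofunctor.StrongTrans.homCategory.ext fun b => ?_
  cases b
  exact entry_injective h

/-- The modification with a given matrix. -/
noncomputable def mkMod {θ θ' : charRep E χ ⟶ charRep E χ'}
    (T : Matrix (Fin ((base θ').R 0 0)) (Fin ((base θ).R 0 0)) ℂ)
    (h : ∀ X, (transMat θ' X).val * T = T * (transMat θ X).val) : θ ⟶ θ' where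
  as :=
    { app := fun _ => (homOfEntry T : base θ ⟶ base θ')
      naturality := fun {a b} X => by
        cases a; cases b
        exact (modification_iff (constraint θ (unmop X)).hom (constraint θ' (unmop X)).hom
          (homOfEntry T)).2 (h (unmop X)) }

end Transformations

/-! ### Different characters -/

section Inequivalent
open MonoidalCategory MonoidalOpposite

local notation "pt" => TwoMat.mk 1

variable {G : Type u₁} [Category.{v₁} G] [MonoidalCategory G]
  {S : Type u₂} [Category.{v₂} S] [MonoidalCategory S] [IsSpecialTwoGroup S]
  {E : G ⥤ S} {χ χ' : CharacterData S}

/-- Every element of `π₁(S)` is realized, via `γ`, by an endomorphism of the image of the unit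
object, and `E` is full. -/
theorem exists_homScalar_ne [E.Full] (h : χ.β ≠ χ'.β) :
    ∃ f : 𝟙_ G ⟶ 𝟙_ G, homScalar E χ f ≠ homScalar E χ' f := by
  obtain ⟨u, hu⟩ := DFunLike.ne_iff.1 h
  obtain ⟨f, hf⟩ := E.map_surjective (gamma (E.obj (𝟙_ G)) u).hom
  refine ⟨f, ?_⟩
  rw [homScalar, homScalar, (gammaInv_eq_iff (E.map f) u).2 hf]
  exact hu

variable [E.Monoidal]

/-- Naturality at an endomorphism of the unit object on which the two characters differ forces an
invertible matrix to vanish. -/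
theorem base_rank_eq_zero [E.Full] (h : χ.β ≠ χ'.β) (θ : charRep E χ ⟶ charRep E χ') :
    (base θ).R 0 0 = 0 := by
  obtain ⟨f, hf⟩ := exists_homScalar_ne (E := E) h
  have key := transMat_natural θ f
  rw [← sub_eq_zero, ← sub_smul] at key
  -- The scalar is nonzero, so an invertible matrix vanishes.
  have h0 := (smul_eq_zero.1 key).resolve_left (sub_ne_zero.2 fun e => hf (Units.ext e))
  by_contra hr
  have : Nonempty (Fin ((base θ).R 0 0)) := ⟨⟨0, Nat.pos_of_ne_zero hr⟩⟩
  exact (transMat θ (𝟙_ G)).ne_zero h0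

/-- The endomorphism of the object `1` of rank `d`, with the trivial gauge. -/
def constRank (d : ℕ) : pt ⟶ pt := (⟨fun _ _ => d, fun _ _ => 1, fun _ _ => rfl⟩ : RankGauge 1 1)

/-- The zero transformation. -/
noncomputable def zeroTrans : charRep E χ ⟶ charRep E χ' :=
  haveI : Subsingleton (Matrix (Fin ((constRank 0).R 0 0)) (Fin ((constRank 0).R 0 0)) ℂ) :=
    inferInstanceAs (Subsingleton (Matrix (Fin 0) (Fin 0) ℂ))
  mkTrans (constRank 0) (fun _ => 1) (fun _ => Subsingleton.elim _ _) (Subsingleton.elim _ _)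
    (fun _ _ => Subsingleton.elim _ _)

theorem hom_equiv_terminal [E.Full] (h : χ.β ≠ χ'.β) :
    Nonempty ((charRep E χ ⟶ charRep E χ') ≌ Discrete PUnit.{1}) := by
  refine (equiv_punit_iff_unique _).2 ⟨⟨zeroTrans⟩, fun θ θ' => ?_⟩
  have : IsEmpty (Fin ((base θ').R 0 0)) := by
    rw [base_rank_eq_zero h θ']; infer_instance
  exact ⟨{ default := mkMod 0 fun X => by rw [Matrix.mul_zero, Matrix.zero_mul]
           uniq := fun Γ => modMat_injective (Subsingleton.elim _ _) }⟩

end Inequivalent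

/-! ### Equal characters: projective representations -/

section Projective
open MonoidalCategory MonoidalOpposite

local notation "pt" => TwoMat.mk 1

variable {G : Type u₁} [Category.{v₁} G] [MonoidalCategory G]
  {S : Type u₂} [Category.{v₂} S] [MonoidalCategory S] [IsSpecialTwoGroup S]
  {E : G ⥤ S} [E.Monoidal] {χ χ' : CharacterData S}

theorem exists_toSkeleton (g : Pi0 G) : ∃ X : G, toSkeleton X = g := Quotient.exists_rep g

theorem monoidHom_toSkeleton (X : G) :
    Skeleton.monoidHom E (toSkeleton X) = toSkeleton (E.obj X) :=
  congr_toSkeleton_of_iso (E.mapIso (fromSkeletonToSkeletonIso X))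

theorem transMat_eq_of_hom (h : χ.β = χ'.β) (θ : charRep E χ ⟶ charRep E χ') {X Y : G}
    (f : X ⟶ Y) : transMat θ X = transMat θ Y := by
  have key := transMat_natural θ f
  rw [homScalar, homScalar, ← h] at key
  exact (Units.ext (smul_right_injective _ (Units.ne_zero _) key)).symm

variable [IsTwoGroup G]

/-- The matrices by which `π₀` acts on (the space underlying) a transformation. The straightened
constraints reverse the order of multiplication, whence the inverse. -/
noncomputable def transAction (h : χ.β = χ'.β) (θ : charRep E χ ⟶ charRep E χ') (g : Pi0 G) :
    GL (Fin ((base θ).R 0 0)) ℂ :=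
  Quotient.lift (fun X : G => (transMat θ X)⁻¹)
    (by rintro _ _ ⟨f⟩; exact congrArg (·⁻¹) (transMat_eq_of_hom h θ f.hom)) g

theorem transAction_toSkeleton (h : χ.β = χ'.β) (θ : charRep E χ ⟶ charRep E χ') (X : G) :
    transAction h θ (toSkeleton X) = (transMat θ X)⁻¹ := rfl

theorem diffCochain_toSkeleton (X Y : G) :
    diffCochain E χ χ' (toSkeleton X) (toSkeleton Y) =
      χ'.c (toSkeleton (E.obj X)) (toSkeleton (E.obj Y)) *
        (χ.c (toSkeleton (E.obj X)) (toSkeleton (E.obj Y)))⁻¹ := by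
  rw [diffCochain, monoidHom_toSkeleton, monoidHom_toSkeleton]

/-- The values of `β` on the coherence of `E` are common to both representations and cancel. -/
theorem compScalar_eq (h : χ.β = χ'.β) (X Y : G) :
    compScalar E χ X Y =
      diffCochain E χ χ' (toSkeleton Y) (toSkeleton X) * compScalar E χ' X Y := by
  rw [compScalar, compScalar, diffCochain_toSkeleton, h, ← mul_assoc,
    mul_right_comm _ _ (χ'.c _ _)⁻¹, mul_inv_cancel, one_mul]

theorem inv_val_of_val_eq_smul {n : ℕ} {A B : GL (Fin n) ℂ} {a : ℂˣ}
    (h : A.val = (a : ℂ) • B.val) : (B⁻¹).val = (a : ℂ) • (A⁻¹).val := by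
  have := congrArg (fun M => (A⁻¹).val * M * (B⁻¹).val) h
  simpa [Matrix.mul_assoc] using this

theorem transMat_tensor_of_eq (h : χ.β = χ'.β) (θ : charRep E χ ⟶ charRep E χ') (X Y : G) :
    (transMat θ (Y ⊗ X)).val = (diffCochain E χ χ' (toSkeleton Y) (toSkeleton X) : ℂ) •
      (transMat θ X * transMat θ Y).val := by
  have key := transMat_tensor θ X Y
  rw [compScalar_eq h, mul_comm, Units.val_mul, mul_smul] at key
  exact smul_right_injective _ (Units.ne_zero _) key

theorem transAction_mul (h : χ.β = χ'.β) (θ : charRep E χ ⟶ charRep E χ') (g k : Pi0 G) :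
    (transAction h θ g).val * (transAction h θ k).val =
      (diffCochain E χ χ' g k : ℂ) • (transAction h θ (g * k)).val := by
  obtain ⟨X, rfl⟩ := exists_toSkeleton g
  obtain ⟨Y, rfl⟩ := exists_toSkeleton k
  have key := inv_val_of_val_eq_smul (transMat_tensor_of_eq h θ Y X)
  rw [_root_.mul_inv_rev] at key
  rw [← Skeleton.toSkeleton_tensorObj]
  exact key

theorem comm_inv_of_comm {m n : ℕ} {A : GL (Fin m) ℂ} {B : GL (Fin n) ℂ}
    {T : Matrix (Fin n) (Fin m) ℂ} (h : B.val * T = T * A.val) :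
    T * (A⁻¹).val = (B⁻¹).val * T := by
  have := congrArg (fun M => (B⁻¹).val * M * (A⁻¹).val) h
  simpa [Matrix.mul_assoc] using this

theorem comm_of_comm_inv {m n : ℕ} {A : GL (Fin m) ℂ} {B : GL (Fin n) ℂ}
    {T : Matrix (Fin n) (Fin m) ℂ} (h : T * (A⁻¹).val = (B⁻¹).val * T) :
    B.val * T = T * A.val := by
  have := congrArg (fun M => B.val * M * A.val) h
  simpa [Matrix.mul_assoc] using this

/-- The functor sending a transformation to its projective representation and a modification to
its matrix. -/
noncomputable def toPRep (h : χ.β = χ'.β) :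
    (charRep E χ ⟶ charRep E χ') ⥤ PRep (Pi0 G) (diffCochain E χ χ') where
  obj θ := ⟨(base θ).R 0 0, transAction h θ, transAction_mul h θ⟩
  map Γ := ⟨modMat Γ, fun g => by
    obtain ⟨X, rfl⟩ := exists_toSkeleton g
    exact comm_inv_of_comm (modMat_comm Γ X)⟩
  map_id _ := rfl
  map_comp _ _ := rfl

theorem PRep.S_one {Γ : Type u₁} [Group Γ] {z : Γ → Γ → ℂˣ} (V : PRep Γ z) :
    (V.S 1).val = (z 1 1 : ℂ) • 1 := by
  have key := congrArg (fun M => M * ((V.S 1)⁻¹).val) (V.mul 1 1)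
  simpa using key

theorem diffCochain_one : diffCochain E χ χ' 1 1 = 1 := by
  rw [diffCochain, map_one, χ.one_left, χ'.one_left, inv_one, mul_one]

instance (h : χ.β = χ'.β) : (toPRep (E := E) h).Faithful where
  map_injective e := modMat_injective (congrArg PRep.Hom.T e)

instance (h : χ.β = χ'.β) : (toPRep (E := E) h).Full where
  map_surjective f :=
    ⟨mkMod f.T fun X => comm_of_comm_inv (f.comm (toSkeleton X)), rfl⟩

/-- The transformation given by a projective representation. -/
noncomputable def ofPRep (h : χ.β = χ'.β) (V : PRep (Pi0 G) (diffCochain E χ χ')) :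
    charRep E χ ⟶ charRep E χ' :=
  mkTrans (constRank V.dim) (fun X => (V.S (toSkeleton X))⁻¹)
    (fun {X Y} f => by
      have : toSkeleton X = toSkeleton Y := by
        have : IsIso f := IsGroupoid.all_isIso f
        exact Quotient.sound ⟨asIso f⟩
      rw [this, homScalar, homScalar, h])
    (by
      -- The cocycle is normalized, so a projective representation is trivial at `1`.
      have key : V.S 1 = 1 := Units.ext (by
        rw [V.S_one, diffCochain_one, Units.val_one, one_smul]; rfl)
      have key' : (V.S 1)⁻¹ = 1 := inv_eq_one.2 key
      rw [unitScalar, unitScalar, h]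
      exact congrArg (_ • ·) (congrArg Units.val key'))
    (fun X Y => by
      have key : (V.S (toSkeleton Y) * V.S (toSkeleton X)).val = _ :=
        V.mul (toSkeleton Y) (toSkeleton X)
      have key' := inv_val_of_val_eq_smul key
      rw [_root_.mul_inv_rev, ← Skeleton.toSkeleton_tensorObj] at key'
      rw [compScalar_eq h, mul_comm, Units.val_mul, mul_smul]
      exact congrArg (_ • ·) key')

theorem transAction_ofPRep (h : χ.β = χ'.β) (V : PRep (Pi0 G) (diffCochain E χ χ')) (g : Pi0 G) :
    transAction h (ofPRep h V) g = V.S g := by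
  obtain ⟨X, rfl⟩ := exists_toSkeleton g
  exact (congrArg (·⁻¹) (transMat_mkTrans _ _ _ _ _ X)).trans (inv_inv _)

instance (h : χ.β = χ'.β) : (toPRep (E := E) h).EssSurj where
  mem_essImage V := by
    have hS : (toPRep h).obj (ofPRep h V) = V := by
      change PRep.mk V.dim (transAction h (ofPRep h V)) _ = V
      congr 1
      exact funext (transAction_ofPRep h V)
    exact ⟨ofPRep h V, ⟨eqToIso hS⟩⟩

instance (h : χ.β = χ'.β) : (toPRep (E := E) h).IsEquivalence where

theorem quotient_cocycle_aux {M : Type} [CommGroup M] {a b c d a' b' c' d' : M}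
    (h : a * b⁻¹ * c * d⁻¹ = a' * b'⁻¹ * c' * d'⁻¹) :
    a' * a⁻¹ * (c' * c⁻¹) = b' * b⁻¹ * (d' * d⁻¹) := by
  rw [← mul_inv_eq_one] at h ⊢
  rw [← inv_eq_one, ← h]
  simp only [_root_.mul_inv_rev, inv_inv]
  simp only [mul_comm, mul_left_comm, mul_assoc]

theorem diffCochain_mem_Z2 (h : χ.β = χ'.β) : diffCochain E χ χ' ∈ Z2 (Pi0 G) := by
  intro x y z
  obtain ⟨X, rfl⟩ := exists_toSkeleton x
  obtain ⟨Y, rfl⟩ := exists_toSkeleton y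
  obtain ⟨Z, rfl⟩ := exists_toSkeleton z
  have key := (χ.coboundary (E.obj X) (E.obj Y) (E.obj Z)).trans
    ((DFunLike.congr_fun h _).trans (χ'.coboundary (E.obj X) (E.obj Y) (E.obj Z)).symm)
  have hXY : toSkeleton (E.obj X) * toSkeleton (E.obj Y) =
      Skeleton.monoidHom E (toSkeleton X * toSkeleton Y) := by
    rw [map_mul, monoidHom_toSkeleton, monoidHom_toSkeleton]
  have hYZ : toSkeleton (E.obj Y) * toSkeleton (E.obj Z) =
      Skeleton.monoidHom E (toSkeleton Y * toSkeleton Z) := by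
    rw [map_mul, monoidHom_toSkeleton, monoidHom_toSkeleton]
  rw [hXY, hYZ] at key
  simp only [diffCochain, monoidHom_toSkeleton]
  exact quotient_cocycle_aux key

variable {Γ : Type u₁} [Group Γ]

/-- Rescaling projective representations by a function on the group changes the cocycle by the
coboundary of the function. -/
def rescale {z w : Γ → Γ → ℂˣ} (t : Γ → ℂˣ)
    (h : ∀ x y, w x y * t (x * y) = t x * t y * z x y) : PRep Γ z ⥤ PRep Γ w where
  obj V :=
    { dim := V.dim
      S := fun g => t g • V.S g
      mul := fun x y => by
        simp only [Units.val_smul, Units.smul_def, Matrix.smul_mul, Matrix.mul_smul, V.mul,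
          smul_smul]
        congr 1
        have := congrArg Units.val (h x y)
        push_cast at this
        rw [this]; ring }
  map f := ⟨f.T, fun g => by
    simp only [Units.val_smul, Units.smul_def, Matrix.smul_mul, Matrix.mul_smul, f.comm]⟩

instance {z w : Γ → Γ → ℂˣ} (t : Γ → ℂˣ) (h : ∀ x y, w x y * t (x * y) = t x * t y * z x y) :
    (rescale t h).Faithful where
  map_injective e := by
    have key := congrArg PRep.Hom.T e
    exact PRep.Hom.ext key

instance {z w : Γ → Γ → ℂˣ} (t : Γ → ℂˣ) (h : ∀ x y, w x y * t (x * y) = t x * t y * z x y) :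
    (rescale t h).Full where
  map_surjective {V W} f := by
    let T : Matrix (Fin W.dim) (Fin V.dim) ℂ := f.T
    refine ⟨⟨T, fun g => ?_⟩, rfl⟩
    have key : T * (t g • V.S g).val = (t g • W.S g).val * T := f.comm g
    simp only [Units.val_smul, Units.smul_def, Matrix.smul_mul, Matrix.mul_smul] at key
    exact smul_right_injective _ (Units.ne_zero (t g)) key

theorem rescale_inv_aux {z w : Γ → Γ → ℂˣ} {t : Γ → ℂˣ}
    (h : ∀ x y, w x y * t (x * y) = t x * t y * z x y) (x y : Γ) :
    z x y * t⁻¹ (x * y) = t⁻¹ x * t⁻¹ y * w x y := by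
  rw [eq_mul_inv_of_mul_eq (h x y)]
  simp only [Pi.inv_apply]
  rw [← mul_assoc, ← mul_assoc, ← _root_.mul_inv_rev, mul_comm (t y), inv_mul_cancel, one_mul]

instance {z w : Γ → Γ → ℂˣ} (t : Γ → ℂˣ) (h : ∀ x y, w x y * t (x * y) = t x * t y * z x y) :
    (rescale t h).EssSurj where
  mem_essImage V := by
    refine ⟨(rescale t⁻¹ (rescale_inv_aux h)).obj V, ⟨eqToIso ?_⟩⟩
    change PRep.mk V.dim (fun g => t g • (t g)⁻¹ • V.S g) _ = V
    congr 1
    exact funext fun g => smul_inv_smul _ _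

instance {z w : Γ → Γ → ℂˣ} (t : Γ → ℂˣ) (h : ∀ x y, w x y * t (x * y) = t x * t y * z x y) :
    (rescale t h).IsEquivalence where

theorem nonempty_equiv_of_cohomologous {z w : Z2 Γ}
    (h : (QuotientGroup.mk z : H2 Γ) = QuotientGroup.mk w) :
    Nonempty (PRep Γ w.1 ≌ PRep Γ z.1) := by
  obtain ⟨t, ht⟩ := QuotientGroup.eq.1 h.symm
  refine ⟨(rescale t fun x y => ?_).asEquivalence⟩
  have key : (w.1 x y)⁻¹ * z.1 x y = t y * (t (x * y))⁻¹ * t x := ht x y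
  rw [eq_mul_of_inv_mul_eq key, mul_assoc, mul_right_comm (t y), inv_mul_cancel_right,
    mul_comm, mul_comm (t y)]

end Projective

/-! ### Composites of endomorphisms of the object `1` and Kronecker products -/

section Tensorator
open MatRep

local notation "pt" => TwoMat.mk 1

variable {X Y X' Y' : Fin 1 → Type} {m n m' n' : ℕ}

/-- A disjoint union over a one-element set. -/
def pairEquiv (X Y : Fin 1 → Type) : X 0 × Y 0 ≃ Σ i, X i × Y i where
  toFun p := ⟨0, p⟩
  invFun | ⟨⟨0, _⟩, p⟩ => p
  left_inv _ := rfl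
  right_inv | ⟨⟨0, _⟩, _⟩ => rfl

/-- The lexicographic enumeration of `Σ i, X i × Y i` induced by enumerations of `X 0` and `Y 0`. -/
def enum (σ : Fin m ≃ X 0) (τ : Fin n ≃ Y 0) : Fin (m * n) ≃ Σ i, X i × Y i :=
  finProdFinEquiv.symm.trans ((σ.prodCongr τ).trans (pairEquiv X Y))

theorem enum_apply (σ : Fin m ≃ X 0) (τ : Fin n ≃ Y 0) (i j) :
    enum σ τ (finProdFinEquiv (i, j)) = ⟨0, σ i, τ j⟩ := by
  simp [enum, pairEquiv]

/-- A block diagonal matrix of Kronecker products with a single block is a Kronecker product, up to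
enumeration of the indices. -/
theorem blockDiagonal'_mul_permMat_enum {a c : Fin 1 → ℕ} [∀ i, DecidableEq (X i)]
    [∀ i, DecidableEq (Y i)] [∀ i, Fintype (X i)] [∀ i, Fintype (Y i)]
    (A : ∀ i, Matrix (Fin (a i)) (X i) ℂ) (C : ∀ i, Matrix (Fin (c i)) (Y i) ℂ)
    (σ : Fin m ≃ X 0) (τ : Fin n ≃ Y 0) :
    Matrix.blockDiagonal' (fun i => A i ⊗ₖ C i) * permMat (enum σ τ) =
      permMat (enum (X := fun i => Fin (a i)) (Y := fun i => Fin (c i)) (Equiv.refl _)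
        (Equiv.refl _)) * kr (A 0 * permMat σ) (C 0 * permMat τ) := by
  rw [mul_permMat, permMat_mul, mul_permMat, mul_permMat]
  ext x y
  obtain ⟨x, rfl⟩ := (enum (X := fun i => Fin (a i)) (Y := fun i => Fin (c i)) (Equiv.refl _)
        (Equiv.refl _)).surjective x
  obtain ⟨⟨i, j⟩, rfl⟩ := finProdFinEquiv.surjective x
  obtain ⟨⟨k, l⟩, rfl⟩ := finProdFinEquiv.surjective y
  rw [Matrix.submatrix_apply, Matrix.submatrix_apply, Equiv.symm_apply_apply, enum_apply, id, id,
    enum_apply, kr_apply, Matrix.blockDiagonal'_apply_eq]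
  rfl

variable {r r' t t' u : pt ⟶ pt}

/-- The enumeration of the index set of a composite of endomorphisms of the object `1`. -/
def pairEnum (r t : pt ⟶ pt) :
    Fin (t.R 0 0 * r.R 0 0) ≃ Σ i, Fin (t.R 0 i) × Fin (r.R i 0) :=
  enum (X := fun i => Fin (t.R 0 i)) (Y := fun i => Fin (r.R i 0)) (Equiv.refl _) (Equiv.refl _)

/-- The entry of `RankGauge.compHom`. -/
def compMat (r t : pt ⟶ pt) :
    Matrix (Fin ((r ≫ t).R 0 0)) (Σ i, Fin (t.R 0 i) × Fin (r.R i 0)) ℂ :=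
  RankGauge.compHom r t 0 0

/-- The entry of `RankGauge.compInv`. -/
noncomputable def compMatInv (r t : pt ⟶ pt) :
    Matrix (Σ i, Fin (t.R 0 i) × Fin (r.R i 0)) (Fin ((r ≫ t).R 0 0)) ℂ :=
  RankGauge.compInv r t 0 0

/-- The isomorphism from the Kronecker product to the composite: the lexicographic enumeration,
corrected by the gauge of the outer 1-morphism. -/
noncomputable def kron (r t : pt ⟶ pt) :
    Matrix (Fin ((r ≫ t).R 0 0)) (Fin (t.R 0 0 * r.R 0 0)) ℂ :=
  compMat r t * permMat (pairEnum r t)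

/-- The inverse of `kron`. -/
noncomputable def kronInv (r t : pt ⟶ pt) :
    Matrix (Fin (t.R 0 0 * r.R 0 0)) (Fin ((r ≫ t).R 0 0)) ℂ :=
  permMat (pairEnum r t).symm * compMatInv r t

theorem compMatInv_mul_compMat (r t : pt ⟶ pt) : compMatInv r t * compMat r t = 1 :=
  perm_gl_inv _ _

theorem compMat_mul_compMatInv (r t : pt ⟶ pt) : compMat r t * compMatInv r t = 1 :=
  gl_perm_inv _ _

theorem kronInv_mul_kron (r t : pt ⟶ pt) :
    kronInv r t * kron r t = (1 : Matrix (Fin (t.R 0 0 * r.R 0 0)) _ ℂ) := by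
  rw [kronInv, kron, Matrix.mul_assoc, ← Matrix.mul_assoc (compMatInv r t),
    compMatInv_mul_compMat, Matrix.one_mul, permMat_mul_permMat, Equiv.self_trans_symm,
    permMat_refl]

theorem kron_mul_kronInv (r t : pt ⟶ pt) :
    kron r t * kronInv r t = (1 : Matrix (Fin ((r ≫ t).R 0 0)) _ ℂ) := by
  rw [kronInv, kron, Matrix.mul_assoc, ← Matrix.mul_assoc (permMat _), permMat_mul_permMat,
    Equiv.symm_trans_self, permMat_refl, Matrix.one_mul, compMat_mul_compMatInv]

local notation "Id(" n ")" => (1 : Matrix (Fin n) (Fin n) ℂ)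

theorem entry_whiskerRight_mul_kron (T : r ⟶ r') (t : pt ⟶ pt) :
    entry (Bicategory.whiskerRight T t) * kron r t =
      kron r' t * kr Id(t.R 0 0) (entry T) := by
  let D : Matrix (Σ i, Fin (t.R 0 i) × Fin (r'.R i 0)) (Σ i, Fin (t.R 0 i) × Fin (r.R i 0)) ℂ :=
    Matrix.blockDiagonal' fun i => Id(t.R 0 i) ⊗ₖ T i 0
  have h : entry (Bicategory.whiskerRight T t) = compMat r' t * D * compMatInv r t := rfl
  have h' := blockDiagonal'_mul_permMat_enum (fun i => Id(t.R 0 i)) (fun i => T i 0)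
    (Equiv.refl _) (Equiv.refl _)
  rw [permMat_refl, permMat_refl, Matrix.mul_one, Matrix.mul_one] at h'
  rw [h, kron, kron, Matrix.mul_assoc, ← Matrix.mul_assoc (compMatInv r t),
    compMatInv_mul_compMat, Matrix.one_mul, Matrix.mul_assoc, Matrix.mul_assoc]
  exact congrArg _ h'

theorem entry_whiskerLeft_mul_kron (r : pt ⟶ pt) (T : t ⟶ t') :
    entry (Bicategory.whiskerLeft r T) * kron r t =
      kron r t' * kr (entry T) Id(r.R 0 0) := by
  let D : Matrix (Σ i, Fin (t'.R 0 i) × Fin (r.R i 0)) (Σ i, Fin (t.R 0 i) × Fin (r.R i 0)) ℂ :=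
    Matrix.blockDiagonal' fun i => T 0 i ⊗ₖ Id(r.R i 0)
  have h : entry (Bicategory.whiskerLeft r T) = compMat r t' * D * compMatInv r t := rfl
  have h' := blockDiagonal'_mul_permMat_enum (fun i => T 0 i) (fun i => Id(r.R i 0))
    (Equiv.refl _) (Equiv.refl _)
  rw [permMat_refl, permMat_refl, Matrix.mul_one, Matrix.mul_one] at h'
  rw [h, kron, kron, Matrix.mul_assoc, ← Matrix.mul_assoc (compMatInv r t),
    compMatInv_mul_compMat, Matrix.one_mul, Matrix.mul_assoc, Matrix.mul_assoc]
  exact congrArg _ h'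

theorem entry_interchange_mul_kron (f : r ⟶ r') (g : t ⟶ t') :
    entry (Bicategory.whiskerLeft r' g) * entry (Bicategory.whiskerRight f t) * kron r t =
      kron r' t' * kr (entry g) (entry f) := by
  rw [Matrix.mul_assoc, entry_whiskerRight_mul_kron, ← Matrix.mul_assoc,
    entry_whiskerLeft_mul_kron, Matrix.mul_assoc, kr_mul, Matrix.one_mul, Matrix.mul_one]

/-- The compatibility of the comparison with associativity: both sides compare a triple Kronecker
product with a triple composite. -/
theorem entry_associator_mul_kron (r t u : pt ⟶ pt) :
    entry (Bicategory.associator r t u).hom * (kron (r ≫ t) u * kr Id(u.R 0 0) (kron r t)) =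
      kron r (t ≫ u) * (kr (kron t u) Id(r.R 0 0) *
        permMat (assocE (u.R 0 0) (t.R 0 0) (r.R 0 0)).symm) := by
  -- The index types of the two ways of forming a triple composite of 2-matrices of sets.
  let L := Σ k, Fin (u.R 0 k) × Σ i, Fin (t.R k i) × Fin (r.R i 0)
  let R := Σ i, (Σ k, Fin (u.R 0 k) × Fin (t.R k i)) × Fin (r.R i 0)
  let σ : L ≃ R := (SetMat.assocE (RankGauge.toSetMat r) (RankGauge.toSetMat t)
    (RankGauge.toSetMat u) 0 0).symm
  let A : Matrix (Σ k, Fin (u.R 0 k) × Fin ((r ≫ t).R k 0)) L ℂ :=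
    SetMat.wr (RankGauge.compHom r t) (RankGauge.toSetMat u) 0 0
  let A' : Matrix L (Σ k, Fin (u.R 0 k) × Fin ((r ≫ t).R k 0)) ℂ :=
    SetMat.wr (RankGauge.compInv r t) (RankGauge.toSetMat u) 0 0
  let B : Matrix (Σ i, Fin ((t ≫ u).R 0 i) × Fin (r.R i 0)) R ℂ :=
    SetMat.wl (RankGauge.toSetMat r) (RankGauge.compHom t u) 0 0
  let eL : Fin (u.R 0 0 * (t.R 0 0 * r.R 0 0)) ≃ L :=
    enum (X := fun i => Fin (u.R 0 i)) (Y := fun k => Σ i, Fin (t.R k i) × Fin (r.R i 0))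
      (Equiv.refl _) (pairEnum r t)
  let eR : Fin (u.R 0 0 * t.R 0 0 * r.R 0 0) ≃ R :=
    enum (X := fun i => Σ k, Fin (u.R 0 k) × Fin (t.R k i)) (Y := fun i => Fin (r.R i 0))
      (pairEnum t u) (Equiv.refl _)
  have hα : entry (Bicategory.associator r t u).hom =
      compMat r (t ≫ u) * B * permMat σ * A' * compMatInv (r ≫ t) u := rfl
  have hA : A' * A = 1 := by
    have := congrFun (congrFun (congrArg (SetMat.wr · (RankGauge.toSetMat u))
      (RankGauge.compIso r t).hom_inv_id) 0) 0
    rw [SetMat.wr_comp, SetMat.comp_app, SetMat.wr_id] at this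
    exact this
  have hr : A * permMat eL = permMat (pairEnum (r ≫ t) u) * kr Id(u.R 0 0) (kron r t) := by
    have := blockDiagonal'_mul_permMat_enum (fun i => Id(u.R 0 i))
      (fun i => RankGauge.compHom r t i 0) (Equiv.refl _) (pairEnum r t)
    rw [permMat_refl, Matrix.mul_one] at this
    exact this
  have hl : B * permMat eR = permMat (pairEnum r (t ≫ u)) * kr (kron t u) Id(r.R 0 0) := by
    have := blockDiagonal'_mul_permMat_enum (fun i => RankGauge.compHom t u 0 i)
      (fun i => Id(r.R i 0)) (pairEnum t u) (Equiv.refl _)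
    rw [permMat_refl, Matrix.mul_one] at this
    exact this
  have hp : permMat σ * permMat eL =
      permMat eR * permMat (assocE (u.R 0 0) (t.R 0 0) (r.R 0 0)).symm := by
    rw [permMat_mul_permMat, permMat_mul_permMat]
    congr 1
    refine Equiv.ext fun x => ?_
    obtain ⟨x, rfl⟩ := (assocE (u.R 0 0) (t.R 0 0) (r.R 0 0)).surjective x
    obtain ⟨⟨x, x₃⟩, rfl⟩ := finProdFinEquiv.surjective x
    obtain ⟨⟨x₁, x₂⟩, rfl⟩ := finProdFinEquiv.surjective x
    rw [Equiv.trans_apply, Equiv.trans_apply, Equiv.symm_apply_apply, assocE_apply, enum_apply,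
      enum_apply, pairEnum, pairEnum, enum_apply, enum_apply]
    rfl
  calc _ = compMat r (t ≫ u) * B * permMat σ * A' *
        (compMatInv (r ≫ t) u * compMat (r ≫ t) u) *
          (permMat (pairEnum (r ≫ t) u) * kr Id(u.R 0 0) (kron r t)) := by
        rw [hα, kron]; simp only [Matrix.mul_assoc]
    _ = compMat r (t ≫ u) * B * permMat σ * (A' * A) * permMat eL := by
        rw [compMatInv_mul_compMat, Matrix.mul_one, ← hr]; simp only [Matrix.mul_assoc]
    _ = compMat r (t ≫ u) * (B * permMat eR) *
          permMat (assocE (u.R 0 0) (t.R 0 0) (r.R 0 0)).symm := by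
        rw [hA, Matrix.mul_one, Matrix.mul_assoc _ (permMat σ), hp]; simp only [Matrix.mul_assoc]
    _ = _ := by
        have hk : kron r (t ≫ u) = compMat r (t ≫ u) * permMat (pairEnum r (t ≫ u)) := rfl
        rw [hl, hk]; simp only [Matrix.mul_assoc]

theorem entry_associator_inv_mul_kron (r t u : pt ⟶ pt) :
    entry (Bicategory.associator r t u).inv * (kron r (t ≫ u) * kr (kron t u) Id(r.R 0 0)) =
      kron (r ≫ t) u * (kr Id(u.R 0 0) (kron r t) *
        permMat (assocE (u.R 0 0) (t.R 0 0) (r.R 0 0))) := by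
  have h := congrArg (fun M => entry (Bicategory.associator r t u).inv * M *
    permMat (assocE (u.R 0 0) (t.R 0 0) (r.R 0 0))) (entry_associator_mul_kron r t u)
  have hp : permMat (assocE (u.R 0 0) (t.R 0 0) (r.R 0 0)).symm *
      permMat (assocE (u.R 0 0) (t.R 0 0) (r.R 0 0)) = 1 := by
    rw [permMat_mul_permMat, Equiv.self_trans_symm, permMat_refl]
  have hα : entry (Bicategory.associator r t u).inv * entry (Bicategory.associator r t u).hom =
      1 := by
    rw [← entry_comp, Iso.hom_inv_id, entry_id]
  simp only [Matrix.mul_assoc, hp, Matrix.mul_one] at h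
  rw [← Matrix.mul_assoc (entry _) (entry _), hα, Matrix.one_mul] at h
  exact h.symm

/-- The enumeration of the only entry of the identity of the object `1`. -/
def unitEnum : Fin 1 ≃ Fin ((𝟙 pt : pt ⟶ pt).R 0 0) := Equiv.refl (Fin 1)

theorem entry_rightUnitor_mul_kron (t : pt ⟶ pt) :
    entry (Bicategory.rightUnitor t).hom *
      (kron t (𝟙 pt) * kr (permMat unitEnum) Id(t.R 0 0)) = permMat (lunitE (t.R 0 0)) := by
  let L := Σ i : Fin 1, PLift ((0 : Fin 1) = i) × Fin (t.R i 0)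
  let R := Σ i : Fin 1, Fin ((𝟙 pt : pt ⟶ pt).R 0 i) × Fin (t.R i 0)
  let σ : L ≃ Fin (t.R 0 0) := SetMat.runitE (RankGauge.toSetMat t) 0 0
  let τ : R ≃ L := Equiv.sigmaCongrRight fun i =>
    (RankGauge.oneEquiv 0 i).symm.prodCongr (Equiv.refl (Fin (t.R i 0)))
  have hτ : SetMat.wl (RankGauge.toSetMat t) (RankGauge.oneIso 1).inv 0 0 = permMat τ :=
    congrFun (congrFun (SetMat.wl_permIso (RankGauge.toSetMat t)
      fun i j => (RankGauge.oneEquiv i j).symm) 0) 0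
  have h : entry (Bicategory.rightUnitor t).hom =
      permMat σ * permMat τ * compMatInv t (𝟙 pt) := by
    rw [← hτ]; rfl
  rw [h, kron, Matrix.mul_assoc, Matrix.mul_assoc, Matrix.mul_assoc (compMat t (𝟙 pt)),
    ← Matrix.mul_assoc (compMatInv t (𝟙 pt)), compMatInv_mul_compMat, Matrix.one_mul,
    kr_permMat_one]
  simp only [permMat_mul_permMat]
  congr 1
  refine Equiv.ext fun x => ?_
  obtain ⟨⟨i, j⟩, rfl⟩ := finProdFinEquiv.surjective x
  simp only [Equiv.trans_apply, Equiv.symm_apply_apply, Equiv.prodCongr_apply, Prod.map,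
    lunitE_apply, pairEnum, enum_apply]
  rfl

theorem entry_leftUnitor_mul_kron (t : pt ⟶ pt) :
    entry (Bicategory.leftUnitor t).hom *
      (kron (𝟙 pt) t * kr Id(t.R 0 0) (permMat unitEnum)) = permMat (runitE (t.R 0 0)) := by
  let L := Σ i : Fin 1, Fin (t.R 0 i) × PLift (i = (0 : Fin 1))
  let R := Σ i : Fin 1, Fin (t.R 0 i) × Fin ((𝟙 pt : pt ⟶ pt).R i 0)
  let σ : L ≃ Fin (t.R 0 0) := SetMat.lunitE (RankGauge.toSetMat t) 0 0
  let τ : R ≃ L := Equiv.sigmaCongrRight fun i =>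
    (Equiv.refl (Fin (t.R 0 i))).prodCongr (RankGauge.oneEquiv i 0).symm
  have hτ : SetMat.wr (RankGauge.oneIso 1).inv (RankGauge.toSetMat t) 0 0 = permMat τ :=
    congrFun (congrFun (SetMat.wr_permIso
      (fun i j => (RankGauge.oneEquiv i j).symm) (RankGauge.toSetMat t)) 0) 0
  have h : entry (Bicategory.leftUnitor t).hom =
      permMat σ * permMat τ * compMatInv (𝟙 pt) t := by
    rw [← hτ]; rfl
  rw [h, kron, Matrix.mul_assoc, Matrix.mul_assoc, Matrix.mul_assoc (compMat (𝟙 pt) t),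
    ← Matrix.mul_assoc (compMatInv (𝟙 pt) t), compMatInv_mul_compMat, Matrix.one_mul,
    kr_one_permMat]
  simp only [permMat_mul_permMat]
  congr 1
  refine Equiv.ext fun x => ?_
  obtain ⟨⟨i, j⟩, rfl⟩ := finProdFinEquiv.surjective x
  simp only [Equiv.trans_apply, Equiv.symm_apply_apply, Equiv.prodCongr_apply, Prod.map,
    runitE_apply, pairEnum, enum_apply]
  rfl

end Tensorator

/-! ### The monoidal category of endomorphisms -/

section Endomorphisms
open MonoidalCategory MonoidalOpposite MatRep

local notation "pt" => TwoMat.mk 1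
local notation "Id(" n ")" => (1 : Matrix (Fin n) (Fin n) ℂ)

variable {G : Type u₁} [Category.{v₁} G] [MonoidalCategory G]
  {S : Type u₂} [Category.{v₂} S] [MonoidalCategory S] [IsSpecialTwoGroup S]
  {E : G ⥤ S} [E.Monoidal] {χ χ' χ'' : CharacterData S}

/-- The comparison `kron` for the 1-morphisms underlying two transformations. -/
noncomputable def transKron (θ : charRep E χ ⟶ charRep E χ') (η : charRep E χ' ⟶ charRep E χ'') :
    Matrix (Fin ((base (θ ≫ η)).R 0 0)) (Fin ((base η).R 0 0 * (base θ).R 0 0)) ℂ :=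
  kron (base θ) (base η)

/-- The inverse of `transKron`. -/
noncomputable def transKronInv (θ : charRep E χ ⟶ charRep E χ')
    (η : charRep E χ' ⟶ charRep E χ'') :
    Matrix (Fin ((base η).R 0 0 * (base θ).R 0 0)) (Fin ((base (θ ≫ η)).R 0 0)) ℂ :=
  kronInv (base θ) (base η)

theorem transKronInv_mul_transKron (θ : charRep E χ ⟶ charRep E χ')
    (η : charRep E χ' ⟶ charRep E χ'') :
    transKronInv θ η * transKron θ η = Id((base η).R 0 0 * (base θ).R 0 0) :=
  kronInv_mul_kron _ _

theorem transKron_mul_transKronInv (θ : charRep E χ ⟶ charRep E χ')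
    (η : charRep E χ' ⟶ charRep E χ'') :
    transKron θ η * transKronInv θ η = Id((base (θ ≫ η)).R 0 0) :=
  kron_mul_kronInv _ _

theorem transMat_comp_mul_transKron (θ : charRep E χ ⟶ charRep E χ')
    (η : charRep E χ' ⟶ charRep E χ'') (X : G) :
    (transMat (θ ≫ η) X).val * transKron θ η =
      transKron θ η * kr (transMat η X).val (transMat θ X).val := by
  have h : (transMat (θ ≫ η) X).val =
      entry (Bicategory.whiskerLeft (base θ) (straighten (constraint η X).hom)) *
      entry (Bicategory.whiskerRight (straighten (constraint θ X).hom) (base η)) :=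
    congrArg entry (straighten_vcomp (constraint θ X).hom (constraint η X).hom)
  exact (congrArg (· * transKron θ η) h).trans (entry_interchange_mul_kron _ _)

theorem transMat_id (χ : CharacterData S) (X : G) : transMat (𝟙 (charRep E χ)) X = 1 := by
  refine Units.ext ?_
  have h : (transMat (𝟙 (charRep E χ)) X).val = entry (straighten
    ((Bicategory.rightUnitor (𝟙 pt)).hom ≫ (Bicategory.leftUnitor (𝟙 pt)).inv)) := rfl
  have h' : straighten ((Bicategory.rightUnitor (𝟙 pt)).hom ≫
      (Bicategory.leftUnitor (𝟙 pt)).inv) = 𝟙 (𝟙 pt) := by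
    simp [straighten]
  rw [h, h']
  rfl

variable [IsTwoGroup G]

/-- The functor sending an endomorphism of `charRep E χ` to its linear representation: for equal
cochains the quotient cochain is `1`. -/
noncomputable def toMatRep (E : G ⥤ S) [E.Monoidal] (χ : CharacterData S) :
    (charRep E χ ⟶ charRep E χ) ⥤ MatRep (Pi0 G) where
  obj θ := ⟨(base θ).R 0 0, MonoidHom.mk' (transAction rfl θ) fun g k => Units.ext (by
    rw [Units.val_mul, transAction_mul, diffCochain, mul_inv_cancel, Units.val_one, one_smul])⟩
  map Γ := ⟨modMat Γ, ((toPRep rfl).map Γ).comm⟩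
  map_id _ := rfl
  map_comp _ _ := rfl

instance : (toMatRep E χ).Faithful where
  map_injective e := modMat_injective (congrArg MatRep.Hom.T e)

instance : (toMatRep E χ).Full where
  map_surjective f :=
    ⟨mkMod f.T fun X => comm_of_comm_inv (f.comm (toSkeleton X)), rfl⟩

instance : (toMatRep E χ).EssSurj where
  mem_essImage V := by
    let W : PRep (Pi0 G) (diffCochain E χ χ) := ⟨V.dim, V.S, fun g k => by
      rw [diffCochain, mul_inv_cancel, Units.val_one, one_smul, map_mul, Units.val_mul]⟩
    have hS : (toMatRep E χ).obj (ofPRep rfl W) = V := by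
      change MatRep.mk V.dim _ = V
      congr 1
      exact MonoidHom.ext (transAction_ofPRep rfl W)
    exact ⟨ofPRep rfl W, ⟨eqToIso hS⟩⟩

instance : (toMatRep E χ).IsEquivalence where

theorem inv_comm_of_comm {m n : ℕ} {K : Matrix (Fin n) (Fin m) ℂ} {L : Matrix (Fin m) (Fin n) ℂ}
    {A : Matrix (Fin m) (Fin m) ℂ} {B : Matrix (Fin n) (Fin n) ℂ} (h₁ : L * K = 1)
    (h₂ : K * L = 1) (h : K * A = B * K) : L * B = A * L := by
  have key := congrArg (fun M => L * M * L) h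
  simp only [Matrix.mul_assoc, h₂, Matrix.mul_one] at key
  rw [← Matrix.mul_assoc, h₁, Matrix.one_mul] at key
  exact key.symm

theorem transAction_comp_mul_transKron (θ η : charRep E χ ⟶ charRep E χ) (g : Pi0 G) :
    transKron θ η * kr (transAction rfl η g).val (transAction rfl θ g).val =
      (transAction rfl (θ ≫ η) g).val * transKron θ η := by
  obtain ⟨X, rfl⟩ := exists_toSkeleton g
  exact comm_inv_of_comm (A := krGL (transMat η X) (transMat θ X))
    (transMat_comp_mul_transKron θ η X)

theorem transAction_comp_mul_transKronInv (θ η : charRep E χ ⟶ charRep E χ) (g : Pi0 G) :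
    transKronInv θ η * (transAction rfl (θ ≫ η) g).val =
      kr (transAction rfl η g).val (transAction rfl θ g).val * transKronInv θ η := by
  exact inv_comm_of_comm (transKronInv_mul_transKron θ η) (transKron_mul_transKronInv θ η)
    (transAction_comp_mul_transKron θ η g)

theorem transAction_id (g : Pi0 G) : transAction rfl (𝟙 (charRep E χ)) g = 1 := by
  obtain ⟨X, rfl⟩ := exists_toSkeleton g
  rw [transAction_toSkeleton, transMat_id, inv_one]

/-- The tensorator of `toMatRep`. The tensor product of `MatRep` corresponds to the composition of
functions `η ∘ θ`, that is, `θ ≫ η`. -/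
noncomputable def toMatRepTensor (θ η : charRep E χ ⟶ charRep E χ) :
    (toMatRep E χ).obj η ⊗ (toMatRep E χ).obj θ ≅ (toMatRep E χ).obj (θ ≫ η) where
  hom := ⟨transKron θ η, transAction_comp_mul_transKron θ η⟩
  inv := ⟨transKronInv θ η, transAction_comp_mul_transKronInv θ η⟩
  hom_inv_id := MatRep.hom_ext (transKronInv_mul_transKron _ _)
  inv_hom_id := MatRep.hom_ext (transKron_mul_transKronInv _ _)

/-- The unit comparison of `toMatRep`. -/
noncomputable def toMatRepUnit (E : G ⥤ S) [E.Monoidal] (χ : CharacterData S) :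
    𝟙_ (MatRep (Pi0 G)) ≅ (toMatRep E χ).obj (𝟙 (charRep E χ)) :=
  MatRep.permIso (V := triv) unitEnum fun g x y => by
    have h : ((toMatRep E χ).obj (𝟙 (charRep E χ))).S g = 1 := transAction_id g
    rw [h]
    rfl

/-- The monoidal structure of the functor from endomorphisms, with tensor product
`ξ' ⊗ ξ = ξ' ∘ ξ`, to representations. -/
noncomputable def toMatRepMonoidal :
    (unmopFunctor (charRep E χ ⟶ charRep E χ) ⋙ toMatRep E χ).CoreMonoidal where
  εIso := toMatRepUnit E χ
  μIso X Y := toMatRepTensor (unmop Y) (unmop X)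
  μIso_hom_natural_left {X X'} f Y := MatRep.hom_ext
    (entry_whiskerLeft_mul_kron (base (unmop Y)) (t := base (unmop X)) (t' := base (unmop X'))
      (f.unmop.as.app _)).symm
  μIso_hom_natural_right {X X'} Y f := MatRep.hom_ext
    (entry_whiskerRight_mul_kron (r := base (unmop X)) (r' := base (unmop X'))
      (f.unmop.as.app _) (base (unmop Y))).symm
  associativity X Y Z := MatRep.hom_ext (by
    refine Eq.trans ?_ ((entry_associator_inv_mul_kron (base (unmop Z)) (base (unmop Y))
      (base (unmop X))).trans ?_)
    · exact Matrix.mul_assoc _ _ _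
    · exact (Matrix.mul_assoc _ _ _).symm)
  left_unitality X := MatRep.hom_ext (by
    refine (entry_rightUnitor_mul_kron (base (unmop X))).symm.trans ?_
    exact (Matrix.mul_assoc _ _ _).symm)
  right_unitality X := MatRep.hom_ext (by
    refine (entry_leftUnitor_mul_kron (base (unmop X))).symm.trans ?_
    exact (Matrix.mul_assoc _ _ _).symm)

end Endomorphisms
end TwoRep

theorem mainTheorem2 {G : Type u₁} [Category.{v₁} G] [MonoidalCategory G] [IsTwoGroup G]
    {S : Type u₂} [Category.{v₂} S] [MonoidalCategory S] [IsSpecialTwoGroup S]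
    (E : G ⥤ S) [E.Monoidal] [E.IsEquivalence] (χ χ' : CharacterData S) :
    (χ.β ≠ χ'.β → Nonempty ((charRep E χ ⟶ charRep E χ') ≌ Discrete PUnit.{1})) ∧
    (χ.β = χ'.β → ∃ hz : diffCochain E χ χ' ∈ Z2 (Pi0 G), ∀ z : Z2 (Pi0 G),
      (QuotientGroup.mk z : H2 (Pi0 G)) = QuotientGroup.mk ⟨diffCochain E χ χ', hz⟩ →
        Nonempty ((charRep E χ ⟶ charRep E χ') ≌ PRep (Pi0 G) z.1)) ∧
    ∃ F : (charRep E χ ⟶ charRep E χ)ᴹᵒᵖ ⥤ MatRep (Pi0 G),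
      F.IsEquivalence ∧ Nonempty F.Monoidal := by
  refine ⟨hom_equiv_terminal, fun h => ⟨diffCochain_mem_Z2 h, fun z hz => ?_⟩,
    unmopFunctor _ ⋙ toMatRep E χ, ?_, ⟨toMatRepMonoidal.toMonoidal⟩⟩
  · obtain ⟨e⟩ := nonempty_equiv_of_cohomologous hz
    exact ⟨(toPRep h).asEquivalence.trans e⟩
  · exact ((MonoidalOpposite.unmopEquiv _).trans (toMatRep E χ).asEquivalence).isEquivalence_functor
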